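/- **Notation.** Let $K$ be a field with $2\ne 0$ and let $q\in K$, $q\neq 0$, be such that $[k]_{q^2}\ne 0$ for all $k\ge 1$, where $[k]_q=1+q+\cdots+q^{k-1}$ and $[k]_q!=[1]_q[2]_q\cdots[k]_q$. (For example, $q$ is an indeterminate over $\mathbb Q$ and $K=\mathbb Q(q)$, or $q$ is a nonzero real number.) On the triangular lattice with horizontal lattice lines use coordinates $(i,j)$, the $i$-axis along a horizontal lattice line with unit half the edge length, the $j$-axis perpendicular to it through a lattice point with unit the height of a unit triangle. A lozenge is the union of two unit triangles that share an edge. Under the symmetric weight $\operatorname{wt}_1$, a vertical lozenge (one whose two triangles share a horizontal edge) with center $(i,j)$ has weight $\frac{q^i+q^{-i}}2$, and every other lozenge has weight $1$. For a region $R$ (a finite set of unit triangles), $\operatorname{M}(R)$ is the sum, over all tilings of $R$ by lozenges, of the product of the weights of the lozenges in the tiling (so $\operatorname{M}(\emptyset)=1$). **The region.** Let $x,d,m$ be non-negative integers with $m\le d$ and let $1\le l_1<l_2<\cdots<l_m\le d$ be integers. Take the halved hexagon whose north, northeast, southeast and south sides have lengths $x$, $2d-m$, $m$, $x+d-m$,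 and whose west side is a vertical zigzag with $2d$ unit steps which, from bottom to top, go alternately up-left and up-right. The zigzag has $d$ bumps (corners pointing west), labelled $1,\dots,d$ from bottom to top; the $j$-axis passes through the tips of the bumps. Remove from the halved hexagon the $d-m$ up-pointing unit triangles at the tips of the bumps whose labels are not among $l_1,\dots,l_m$. Let $A_{x,d}(l_1,\dots,l_m)$ be the resulting region, with lozenge weights $\operatorname{wt}_1$. **The product.** For non-negative integers $x,\ m\le d,\ n\le u$ and integers $1\le l_1<\dots<l_m\le d$, $1\le h_1<\dots<h_n\le u$, put $e=\min(u-n,d-m)$, $\overline x=x+\max(u-n,d-m)$, $t_1=2(x+u-n-e)+1$, $t_2=2(x+d-m-e)$, $f(t,a,b)=\frac{ab(2t+a-b)}2$, $\left\langle{b\atop a}\right\rangle=a+(a+1)+\cdots+b$ for $0\le a\le b$, $$E=f(t_1+2d-m,n,m+1)+\sum_{i=1}^m\left\langle{t_1+2d-m-(m-i+1)\atop t_1+2(d-l_i)-2(m-i)}\right\rangle+\sum_{i=1}^n\left\langle{t_2+2u-n-(n-i+1)\atop t_2+2(u-h_i)-2(n-i)}\right\rangle,$$ $$F=n(m+1)+\sum_{i=1}^m(2l_i-i)+\sum_{i=1}^n(2h_i-i),$$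 and $$\begin{aligned}P(x,u,d,(l_i)_{i=1}^m,(h_j)_{j=1}^n)={}&2^{-F}q^{-E}\,\frac{\prod_{1\le i<j\le m}[2(l_j-l_i)]_{q^2}\prod_{1\le i<j\le n}[2(h_j-h_i)]_{q^2}}{\prod_{i=1}^m\prod_{j=1}^n[2(l_i+h_j)]_{q^2}\prod_{i=1}^m[2l_i-1]_{q^2}!\prod_{j=1}^n[2h_j]_{q^2}!}\\ &\times\prod_{i=1}^{\lceil m/2\rceil}\prod_{j=1}^{2m-4i+3}[2\overline x+2i+j-1]_{q^2}\\ &\times\prod_{i=1}^n[2(\overline x+m+i)]_{q^2}\prod_{i=1}^n\prod_{j=1}^{m+i}[2\overline x+m+i+j]_{q^2}\\ &\times\prod_{i=1}^m\prod_{j=1}^n\frac{[2(\overline x+i+j-1)]_{q^2}}{[2(\overline x+i+j-1)+1]_{q^2}}\\ &\times\prod_{i=1}^m\prod_{j=1}^{l_i-i}[2(\overline x+i+j+n)]_{q^2}[2(\overline x-i-j+m+1)]_{q^2}\\ &\times\prod_{i=1}^n\prod_{j=1}^{h_i-i}[2(\overline x+i+j+m)]_{q^2}[2(\overline x-i-j+n+1)]_{q^2}.\end{aligned}$$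 **Theorem (Formula for a region of type A).** For all non-negative integers $x,d,m$ with $m\le d$ and all integers $1\le l_1<\cdots<l_m\le d$, $$\operatorname{M}(A_{x,d}(l_1,\dots,l_m))=P(x,0,d,(l_i)_{i=1}^m,\emptyset),$$ that is, with $\overline x=x+d-m$, $F=\sum_{i=1}^m(2l_i-i)$ and $E=\sum_{i=1}^m\left\langle{2x+2d-2m+i\atop 2x+2d+1-2l_i-2m+2i}\right\rangle$, $$\operatorname{M}(A_{x,d}(l_1,\dots,l_m))=2^{-F}q^{-E}\,\frac{\prod_{1\le i<j\le m}[2(l_j-l_i)]_{q^2}}{\prod_{i=1}^m[2l_i-1]_{q^2}!}\prod_{i=1}^{\lceil m/2\rceil}\prod_{j=1}^{2m-4i+3}[2\overline x+2i+j-1]_{q^2}\prod_{i=1}^m\prod_{j=1}^{l_i-i}[2(\overline x+i+j)]_{q^2}[2(\overline x-i-j+m+1)]_{q^2}.$$ -/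

import Mathlib

namespace HalvedHexagon

open Finset

/-- Unit triangles of the triangular lattice. Cartesian units: half an edge length horizontally
(the `i`-axis) and the height of a unit triangle vertically (the `j`-axis); the lattice vertices
are then the integer points `(a, b)` with `a + b` even, and the origin is one of them.
The pair `(i, j)` stands for the unit triangle lying between the horizontal lines at heights
`j` and `j + 1` whose apex and base midpoint both have abscissa `i`. -/
abbrev Triangle := ℤ × ℤ

/-- Up-pointing unit triangles: vertices `(i - 1, j)`, `(i + 1, j)`, `(i, j + 1)`. -/
def IsUp (t : Triangle) : Prop := Odd (t.1 + t.2)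

/-- Down-pointing unit triangles: vertices `(i - 1, j + 1)`, `(i + 1, j + 1)`, `(i, j)`. -/
def IsDown (t : Triangle) : Prop := Even (t.1 + t.2)

instance : DecidablePred IsUp := fun t => inferInstanceAs (Decidable (Odd (t.1 + t.2)))
instance : DecidablePred IsDown := fun t => inferInstanceAs (Decidable (Even (t.1 + t.2)))

/-- The pair `(s, t)` is the lozenge made of the up-pointing unit triangle `s` and the
down-pointing unit triangle `t`, which share an edge: either they are neighbours in the same row,
or `t` lies directly below the horizontal edge of `s` (a vertical lozenge). -/
def IsLozenge (L : Triangle × Triangle) : Prop :=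
  IsUp L.1 ∧ IsDown L.2 ∧
    ((L.1.2 = L.2.2 ∧ |L.1.1 - L.2.1| = 1) ∨ (L.1.1 = L.2.1 ∧ L.1.2 = L.2.2 + 1))

instance : DecidablePred IsLozenge := fun L => by unfold IsLozenge; infer_instance

/-- The lozenge tilings of a finite region (a finite set of unit triangles): sets of lozenges
contained in the region such that each unit triangle of the region lies in exactly one of them. -/
def tilings (R : Finset Triangle) : Finset (Finset (Triangle × Triangle)) :=
  ((R ×ˢ R).filter IsLozenge).powerset.filter fun T =>
    ∀ t ∈ R, (T.filter fun L => L.1 = t ∨ L.2 = t).card = 1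

/-- The symmetric weight of a lozenge: a vertical lozenge whose center has abscissa `i` has weight
`(q ^ i + q ^ (-i)) / 2`; every other lozenge has weight `1`. The two triangles of a lozenge have
the same abscissa exactly when the lozenge is vertical, and then the midpoint of their common
edge, i.e. the center, has this abscissa. -/
def wt1 {K : Type*} [Field K] (q : K) (L : Triangle × Triangle) : K :=
  if L.1.1 = L.2.1 then (q ^ L.1.1 + q ^ (-L.1.1)) / 2 else 1

/-- The tiling generating function of the region `R` with lozenge weight `wt`. -/
def tgf {K : Type*} [Field K] (wt : Triangle × Triangle → K) (R : Finset Triangle) : K :=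
  ∑ T ∈ tilings R, ∏ L ∈ T, wt L

/-- The halved hexagon with north, northeast, southeast and south sides of lengths
`x`, `2d - m`, `m`, `x + d - m`, whose west side is a vertical zigzag with `2d` unit steps going
alternately up-left and up-right from the southwest corner `(1, -1)` to the northwest corner
`(1, 2d - 1)`. The westernmost lattice points of the zigzag, the tips of the `d` bumps, are
`(0, 0), (0, 2), …, (0, 2d - 2)`; so the `j`-axis is tangent to the west side.
The unit triangle `(i, j)` belongs to the region iff it is in one of the `2d` rows, to the right
of the `j`-axis, on the left of the line `a + b = 2(x + d)` carrying the northeast side, and on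
the left of the line `a - b = 2(x + d - m) + 2` carrying the southeast side. -/
noncomputable def halvedHexagon (x d m : ℕ) : Finset Triangle :=
  (Icc (1 : ℤ) (2 * (x + d)) ×ˢ Icc (-1 : ℤ) (2 * d - 2)).filter fun t =>
    t.1 + t.2 + 1 ≤ 2 * ((x : ℤ) + d) ∧ t.1 - t.2 ≤ 2 * ((x : ℤ) + d - m) + 2

/-- The up-pointing unit triangle of the `k`-th bump of the west side (counted from the bottom,
starting with `k = 1`); its vertices are the tip `(0, 2k - 2)` and `(2, 2k - 2)`, `(1, 2k - 1)`. -/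
def bump (k : ℕ) : Triangle := (1, 2 * (k : ℤ) - 2)

/-- The shape of the region `A_{x,d}(l_1, …, l_m)`: the up-pointing unit triangles of all bumps
except those at the positions `l_1, …, l_m` are removed from the halved hexagon. -/
noncomputable def regionA (x d m : ℕ) (l : ℕ → ℕ) : Finset Triangle :=
  halvedHexagon x d m \ ((Icc 1 d \ (Icc 1 m).image l).image bump)

/-- The `q`-integer `[n]_q = 1 + q + ⋯ + q ^ (n - 1)`. -/
def qInt {K : Type*} [Field K] (q : K) (n : ℕ) : K := ∑ k ∈ range n, q ^ k

/-- The `q`-factorial `[n]_q! = [1]_q [2]_q ⋯ [n]_q`. -/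
def qFact {K : Type*} [Field K] (q : K) (n : ℕ) : K := ∏ k ∈ Icc 1 n, qInt q k

/-- `⟨b; a⟩ = a + (a + 1) + ⋯ + b` for `0 ≤ a ≤ b`. -/
noncomputable def angle (b a : ℤ) : ℤ := ∑ k ∈ Icc a b, k

/-- `f(t, x, y) = xy(2t + x - y) / 2`; the division is exact, as `xy(x - y)` is even. -/
def auxf (t x y : ℤ) : ℤ := x * y * (2 * t + x - y) / 2

/-- The number `e = min(u - n, d - m)`. -/
def eParam (u d m n : ℕ) : ℤ := min ((u : ℤ) - n) ((d : ℤ) - m)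

/-- The number `t₁ = 2(x + u - n - e) + 1`. -/
def t1Param (x u d m n : ℕ) : ℤ := 2 * ((x : ℤ) + u - n - eParam u d m n) + 1

/-- The number `t₂ = 2(x + d - m - e)`. -/
def t2Param (x u d m n : ℕ) : ℤ := 2 * ((x : ℤ) + d - m - eParam u d m n)

/-- The exponent `E(x, u, d, l, h)`. -/
noncomputable def expE (x u d m n : ℕ) (l h : ℕ → ℕ) : ℤ :=
  auxf (t1Param x u d m n + 2 * d - m) n (m + 1)
    + ∑ i ∈ Icc 1 m,
        angle (t1Param x u d m n + 2 * d - m - ((m : ℤ) - i + 1))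
          (t1Param x u d m n + 2 * ((d : ℤ) - l i) - 2 * ((m : ℤ) - i))
    + ∑ i ∈ Icc 1 n,
        angle (t2Param x u d m n + 2 * u - n - ((n : ℤ) - i + 1))
          (t2Param x u d m n + 2 * ((u : ℤ) - h i) - 2 * ((n : ℤ) - i))

/-- The exponent `F(l, h)`. -/
def expF (m n : ℕ) (l h : ℕ → ℕ) : ℤ :=
  (n : ℤ) * (m + 1) + ∑ i ∈ Icc 1 m, (2 * (l i : ℤ) - i) + ∑ i ∈ Icc 1 n, (2 * (h i : ℤ) - i)

/-- The number `x̄ = x + max(u - n, d - m)`, for `n ≤ u` and `m ≤ d`. -/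
def xBar (x u d m n : ℕ) : ℕ := x + max (u - n) (d - m)

/-- The product `P(x, u, d, (l_i)_{i=1}^m, (h_j)_{j=1}^n)`, meant for `m ≤ d`, `n ≤ u` and
strictly increasing sequences `1 ≤ l_1 < ⋯ < l_m ≤ d`, `1 ≤ h_1 < ⋯ < h_n ≤ u`; for these no
subtraction of natural numbers below is truncated. Only `l 1, …, l m` and `h 1, …, h n` matter. -/
noncomputable def P {K : Type*} [Field K] (q : K) (x u d m n : ℕ) (l h : ℕ → ℕ) : K :=
  (2 : K) ^ (-expF m n l h) * q ^ (-expE x u d m n l h)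
    * (((∏ i ∈ Icc 1 m, ∏ j ∈ Icc (i + 1) m, qInt (q ^ 2) (2 * (l j - l i)))
          * ∏ i ∈ Icc 1 n, ∏ j ∈ Icc (i + 1) n, qInt (q ^ 2) (2 * (h j - h i)))
        / ((∏ i ∈ Icc 1 m, ∏ j ∈ Icc 1 n, qInt (q ^ 2) (2 * (l i + h j)))
          * (∏ i ∈ Icc 1 m, qFact (q ^ 2) (2 * l i - 1))
          * ∏ j ∈ Icc 1 n, qFact (q ^ 2) (2 * h j)))
    * (∏ i ∈ Icc 1 ((m + 1) / 2), ∏ j ∈ Icc 1 (2 * m + 3 - 4 * i),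
        qInt (q ^ 2) (2 * xBar x u d m n + 2 * i + j - 1))
    * (∏ i ∈ Icc 1 n, qInt (q ^ 2) (2 * (xBar x u d m n + m + i)))
    * (∏ i ∈ Icc 1 n, ∏ j ∈ Icc 1 (m + i), qInt (q ^ 2) (2 * xBar x u d m n + m + i + j))
    * (∏ i ∈ Icc 1 m, ∏ j ∈ Icc 1 n,
        qInt (q ^ 2) (2 * (xBar x u d m n + i + j - 1))
          / qInt (q ^ 2) (2 * (xBar x u d m n + i + j - 1) + 1))
    * (∏ i ∈ Icc 1 m, ∏ j ∈ Icc 1 (l i - i),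
        qInt (q ^ 2) (2 * (xBar x u d m n + i + j + n))
          * qInt (q ^ 2) (2 * (xBar x u d m n + m + 1 - i - j)))
    * (∏ i ∈ Icc 1 n, ∏ j ∈ Icc 1 (h i - i),
        qInt (q ^ 2) (2 * (xBar x u d m n + i + j + m))
          * qInt (q ^ 2) (2 * (xBar x u d m n + n + 1 - i - j)))

end HalvedHexagon

namespace HalvedHexagon

open Finset

section Expansion

variable {K : Type*} [Field K]

theorem mem_tilings {R : Finset Triangle} {T : Finset (Triangle × Triangle)} :
    T ∈ tilings R ↔ (∀ L ∈ T, L.1 ∈ R ∧ L.2 ∈ R ∧ IsLozenge L) ∧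
      ∀ t ∈ R, ∃! L, L ∈ T ∧ (L.1 = t ∨ L.2 = t) := by
  simp only [tilings, mem_filter, mem_powerset, subset_iff, mem_product, and_assoc]
  refine and_congr Iff.rfl (forall₂_congr fun t _ => ?_)
  rw [card_eq_one]
  constructor
  · rintro ⟨L, hL⟩
    refine ⟨L, by simpa using hL.ge (mem_singleton_self L), fun L' hL' => ?_⟩
    exact mem_singleton.1 (hL.le (mem_filter.2 hL'))
  · rintro ⟨L, hL, huniq⟩
    refine ⟨L, Finset.ext fun L' => ?_⟩
    rw [mem_filter, mem_singleton]
    exact ⟨huniq L', fun h => h ▸ hL⟩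

theorem not_isUp_and_isDown {t : Triangle} (h : IsUp t) (h' : IsDown t) : False :=
  (Int.not_odd_iff_even.2 h') h

theorem IsLozenge.ne {L : Triangle × Triangle} (h : IsLozenge L) : L.1 ≠ L.2 := fun e =>
  not_isUp_and_isDown h.1 (e ▸ h.2.1)

theorem erase_mem_tilings {R : Finset Triangle} {T : Finset (Triangle × Triangle)}
    {L : Triangle × Triangle} (hT : T ∈ tilings R) (hL : L ∈ T) :
    T.erase L ∈ tilings (R \ {L.1, L.2}) := by
  rw [mem_tilings] at hT ⊢
  obtain ⟨h1, h2⟩ := hT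
  have hLR := h1 L hL
  constructor
  · intro L' hL'
    rw [mem_erase] at hL'
    have h3 := h1 L' hL'.2
    have key : ∀ t, t ∈ R → (L.1 = t ∨ L.2 = t) → ¬ (L'.1 = t ∨ L'.2 = t) := fun t ht h h' =>
      hL'.1 ((h2 t ht).unique ⟨hL'.2, h'⟩ ⟨hL, h⟩)
    have k1 := key L.1 hLR.1 (Or.inl rfl)
    have k2 := key L.2 hLR.2.1 (Or.inr rfl)
    simp only [mem_sdiff, mem_insert, mem_singleton]
    tauto
  · intro t ht
    simp only [mem_sdiff, mem_insert, mem_singleton, not_or] at ht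
    obtain ⟨L', hL', huniq⟩ := h2 t ht.1
    refine ⟨L', ⟨mem_erase.2 ⟨?_, hL'.1⟩, hL'.2⟩, fun L'' h => ?_⟩
    · rintro rfl
      rcases hL'.2 with h | h
      · exact ht.2.1 h.symm
      · exact ht.2.2 h.symm
    · exact huniq L'' ⟨mem_of_mem_erase h.1, h.2⟩

theorem insert_mem_tilings {R : Finset Triangle} {T : Finset (Triangle × Triangle)}
    {L : Triangle × Triangle} (hL : IsLozenge L) (hL1 : L.1 ∈ R) (hL2 : L.2 ∈ R)
    (hT : T ∈ tilings (R \ {L.1, L.2})) : L ∉ T ∧ insert L T ∈ tilings R := by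
  rw [mem_tilings] at hT ⊢
  obtain ⟨h1, h2⟩ := hT
  simp only [mem_sdiff, mem_insert, mem_singleton, not_or] at h1 h2
  refine ⟨fun h => (h1 L h).1.2.1 rfl, ?_, ?_⟩
  · intro L' hL'
    rcases mem_insert.1 hL' with rfl | h
    · exact ⟨hL1, hL2, hL⟩
    · exact ⟨(h1 L' h).1.1, (h1 L' h).2.1.1, (h1 L' h).2.2⟩
  · intro t ht
    by_cases hLt : L.1 = t ∨ L.2 = t
    · refine ⟨L, ⟨mem_insert_self _ _, hLt⟩, fun L' h => ?_⟩
      rcases mem_insert.1 h.1 with h' | h'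
      · exact h'
      · have := h1 L' h'
        rcases hLt with rfl | rfl <;> rcases h.2 with e | e <;> simp [e] at this
    · push Not at hLt
      obtain ⟨L', hL', huniq⟩ := h2 t ⟨ht, hLt.1.symm, hLt.2.symm⟩
      refine ⟨L', ⟨mem_insert_of_mem hL'.1, hL'.2⟩, fun L'' h => ?_⟩
      rcases mem_insert.1 h.1 with rfl | h'
      · exact absurd h.2 (by tauto)
      · exact huniq L'' ⟨h', h.2⟩

/-- Expansion of the tiling generating function along the lozenges covering a given triangle. -/
theorem tgf_expand (wt : Triangle × Triangle → K) {R : Finset Triangle} {t : Triangle}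
    (ht : t ∈ R) :
    tgf wt R = ∑ L ∈ (R ×ˢ R).filter (fun L => IsLozenge L ∧ (L.1 = t ∨ L.2 = t)),
      wt L * tgf wt (R \ {L.1, L.2}) := by
  have h1 : tgf wt R = ∑ T ∈ tilings R,
      ∑ L ∈ (R ×ˢ R).filter (fun L => IsLozenge L ∧ (L.1 = t ∨ L.2 = t)),
        if L ∈ T then ∏ L' ∈ T, wt L' else 0 := by
    refine sum_congr rfl fun T hT => ?_
    obtain ⟨hT1, hT2⟩ := mem_tilings.1 hT
    obtain ⟨L, hL, huniq⟩ := hT2 t ht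
    have := hT1 L hL.1
    rw [sum_eq_single L]
    · rw [if_pos hL.1]
    · intro L' hL' hne
      rw [mem_filter] at hL'
      exact if_neg fun h => hne (huniq L' ⟨h, hL'.2.2⟩)
    · intro h
      exact absurd (mem_filter.2 ⟨mem_product.2 ⟨this.1, this.2.1⟩, this.2.2, hL.2⟩) h
  rw [h1, sum_comm]
  refine sum_congr rfl fun L hL => ?_
  simp only [mem_filter, mem_product] at hL
  rw [← sum_filter, tgf, mul_sum]
  refine sum_bij' (fun T _ => T.erase L) (fun T _ => insert L T) ?_ ?_ ?_ ?_ ?_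
  · intro T hT
    rw [mem_filter] at hT
    exact erase_mem_tilings hT.1 hT.2
  · intro T hT
    exact mem_filter.2 ⟨(insert_mem_tilings hL.2.1 hL.1.1 hL.1.2 hT).2, mem_insert_self _ _⟩
  · intro T hT
    exact insert_erase (mem_filter.1 hT).2
  · intro T hT
    exact erase_insert (insert_mem_tilings hL.2.1 hL.1.1 hL.1.2 hT).1
  · intro T hT
    exact (mul_prod_erase T wt (mem_filter.1 hT).2).symm

theorem tgf_empty (wt : Triangle × Triangle → K) : tgf wt ∅ = 1 := by
  have : tilings ∅ = {∅} := by
    ext T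
    simp only [mem_tilings, notMem_empty, false_and, IsEmpty.forall_iff, implies_true, and_true,
      mem_singleton]
    constructor
    · intro h
      exact eq_empty_of_forall_notMem h
    · rintro rfl L hL
      exact notMem_empty _ hL
  simp [tgf, this]

theorem tgf_eq_of_isDown (q : K) {R : Finset Triangle} {i j : ℤ} (ht : (i, j) ∈ R)
    (hd : IsDown (i, j)) (hr : (i + 1, j) ∉ R) :
    tgf (wt1 q) R =
      (if (i - 1, j) ∈ R then tgf (wt1 q) (R \ {(i, j), (i - 1, j)}) else 0) +
      (if (i, j + 1) ∈ R then
        (q ^ i + q ^ (-i)) / 2 * tgf (wt1 q) (R \ {(i, j), (i, j + 1)}) else 0) := by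
  have hu1 : IsUp (i - 1, j) := by
    simp only [IsUp, IsDown] at *; grind
  have hu2 : IsUp (i, j + 1) := by
    simp only [IsUp, IsDown] at *; grind
  have hset : (R ×ˢ R).filter (fun L => IsLozenge L ∧ (L.1 = (i, j) ∨ L.2 = (i, j))) =
      (if (i - 1, j) ∈ R then {((i - 1, j), (i, j))} else ∅) ∪
      (if (i, j + 1) ∈ R then {((i, j + 1), (i, j))} else ∅) := by
    ext ⟨⟨a, b⟩, ⟨a', b'⟩⟩
    simp only [mem_filter, mem_product, mem_union]
    constructor
    · rintro ⟨⟨h1, h2⟩, ⟨h3, h4, h5⟩, h6 | h6⟩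
      · exact absurd (h6 ▸ hd) (fun h => not_isUp_and_isDown h3 h)
      · simp only [Prod.mk.injEq] at h6
        obtain ⟨rfl, rfl⟩ := h6
        simp only at h5
        rcases h5 with ⟨rfl, h5⟩ | ⟨rfl, rfl⟩
        · rcases (abs_eq zero_le_one).1 h5 with h | h
          · obtain rfl : a = a' + 1 := by omega
            exact absurd h1 hr
          · obtain rfl : a = a' - 1 := by omega
            left; simp [h1]
        · right; simp [h1]
    · rintro (h | h)
      · split_ifs at h with h1
        · simp only [mem_singleton, Prod.mk.injEq] at h
          obtain ⟨⟨rfl, rfl⟩, rfl, rfl⟩ := h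
          exact ⟨⟨h1, ht⟩, ⟨hu1, hd, Or.inl ⟨rfl, by simp⟩⟩, Or.inr rfl⟩
        · simp at h
      · split_ifs at h with h1
        · simp only [mem_singleton, Prod.mk.injEq] at h
          obtain ⟨⟨rfl, rfl⟩, rfl, rfl⟩ := h
          exact ⟨⟨h1, ht⟩, ⟨hu2, hd, Or.inr ⟨rfl, rfl⟩⟩, Or.inr rfl⟩
        · simp at h
  rw [tgf_expand _ ht, hset, sum_union]
  · congr 1
    · split_ifs
      · simp [wt1, pair_comm]
      · simp
    · split_ifs
      · simp [wt1, pair_comm]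
      · simp
  · split_ifs <;> simp

theorem tgf_eq_of_isUp (q : K) {R : Finset Triangle} {i j : ℤ} (ht : (i, j) ∈ R)
    (hu : IsUp (i, j)) (hr : (i + 1, j) ∉ R) (hb : (i, j - 1) ∉ R) :
    tgf (wt1 q) R =
      if (i - 1, j) ∈ R then tgf (wt1 q) (R \ {(i, j), (i - 1, j)}) else 0 := by
  have hd1 : IsDown (i - 1, j) := by
    simp only [IsUp, IsDown] at *; grind
  have hset : (R ×ˢ R).filter (fun L => IsLozenge L ∧ (L.1 = (i, j) ∨ L.2 = (i, j))) =
      (if (i - 1, j) ∈ R then {((i, j), (i - 1, j))} else ∅) := by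
    ext ⟨⟨a, b⟩, ⟨a', b'⟩⟩
    simp only [mem_filter, mem_product]
    constructor
    · rintro ⟨⟨h1, h2⟩, ⟨h3, h4, h5⟩, h6 | h6⟩
      · simp only [Prod.mk.injEq] at h6
        obtain ⟨rfl, rfl⟩ := h6
        simp only at h5
        rcases h5 with ⟨rfl, h5⟩ | ⟨rfl, rfl⟩
        · rcases (abs_eq zero_le_one).1 h5 with h | h
          · obtain rfl : a' = a - 1 := by omega
            simp [h2]
          · obtain rfl : a' = a + 1 := by omega
            exact absurd h2 hr
        · exact absurd h2 (by simpa using hb)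
      · exact absurd (h6 ▸ hu) (fun h => not_isUp_and_isDown h h4)
    · intro h
      split_ifs at h with h1
      · simp only [mem_singleton, Prod.mk.injEq] at h
        obtain ⟨⟨rfl, rfl⟩, rfl, rfl⟩ := h
        exact ⟨⟨ht, h1⟩, ⟨hu, hd1, Or.inl ⟨rfl, by simp⟩⟩, Or.inl rfl⟩
      · simp at h
  rw [tgf_expand _ ht, hset]
  split_ifs
  · rw [sum_singleton, wt1, if_neg (by simp only; omega), one_mul]
  · simp

/-- Removal of forced lozenges, each consisting of an up-pointing triangle of `U` and its left
neighbour. -/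
theorem tgf_sdiff_forced (q : K) (U R : Finset Triangle)
    (hU : ∀ u ∈ U, u ∈ R ∧ IsUp u ∧ (u.1 + 1, u.2) ∉ R ∧ (u.1, u.2 - 1) ∉ R ∧
      (u.1 - 1, u.2) ∈ R) :
    tgf (wt1 q) R = tgf (wt1 q) (R \ (U ∪ U.image fun u => (u.1 - 1, u.2))) := by
  induction U using Finset.induction_on generalizing R with
  | empty => simp
  | insert u U hu ih =>
    obtain ⟨h1, h2, h3, h4, h5⟩ := hU u (mem_insert_self _ _)
    obtain ⟨i, j⟩ := u
    rw [tgf_eq_of_isUp q h1 h2 h3 h4, if_pos h5, ih]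
    · congr 1
      ext t
      simp only [mem_sdiff, mem_union, mem_insert, mem_singleton, mem_image, image_insert]
      generalize (∃ a ∈ U, (a.1 - 1, a.2) = t) = p
      tauto
    · rintro ⟨i', j'⟩ hu'
      obtain ⟨h1', h2', h3', h4', h5'⟩ := hU _ (mem_insert_of_mem hu')
      have hne : (i', j') ≠ (i, j) := fun e => hu (e ▸ hu')
      simp only [IsUp, ne_eq, Prod.mk.injEq] at h2 h2' hne
      refine ⟨?_, h2', fun h => h3' (mem_sdiff.1 h).1, fun h => h4' (mem_sdiff.1 h).1, ?_⟩ <;>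
      · simp only [mem_sdiff, mem_insert, mem_singleton, Prod.mk.injEq, h1', h5', true_and]
        grind

end Expansion

section Brackets

variable {K : Type*} [Field K]

open Classical in
/-- The symmetric `q`-integer `(q ^ n - q ^ (-n)) / (q - q⁻¹)`, extended by continuity to
`q = ±1`. -/
noncomputable def symInt (q : K) (n : ℤ) : K :=
  if q ^ 2 = 1 then n * q ^ (n - 1) else (q ^ n - q ^ (-n)) / (q - q⁻¹)

theorem sub_inv_ne_zero_of_sq_ne_one {q : K} (hq : q ≠ 0) (h : q ^ 2 ≠ 1) : q - q⁻¹ ≠ 0 := by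
  intro h'
  apply h
  field_simp at h'
  linear_combination h'

theorem zpow_even_of_sq_eq_one {q : K} (h : q ^ 2 = 1) (n : ℤ) : q ^ (2 * n) = 1 := by
  rw [zpow_mul, zpow_ofNat, h, one_zpow]

theorem symInt_add {q : K} (hq : q ≠ 0) (a b : ℤ) :
    symInt q (a + b) = symInt q a * symInt q (b + 1) - symInt q (a - 1) * symInt q b := by
  unfold symInt
  split_ifs with h
  · have e1 : q ^ (a - 1) * q ^ (b + 1 - 1) = q ^ (a + b - 1) := by
      rw [← zpow_add₀ hq]; congr 1; ring
    have e2 : q ^ (a - 1 - 1) * q ^ (b - 1) = q ^ (a + b - 1) := by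
      rw [← zpow_add₀ hq, show a + b - 1 = (a - 1 - 1 + (b - 1)) + 2 * 1 by ring, zpow_add₀ hq _ (2 * 1),
        zpow_even_of_sq_eq_one h, mul_one]
    push_cast
    linear_combination (-a * (b + 1) : K) * e1 + ((a - 1) * b : K) * e2
  · have := sub_inv_ne_zero_of_sq_ne_one hq h
    rw [div_mul_div_comm, div_mul_div_comm, ← sub_div, div_eq_div_iff this (mul_ne_zero this this)]
    simp only [neg_add, neg_sub, zpow_add₀ hq, zpow_sub₀ hq, zpow_neg, zpow_one]
    have := zpow_ne_zero a hq
    have := zpow_ne_zero b hq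
    field_simp
    ring

@[simp] theorem symInt_zero (q : K) : symInt q 0 = 0 := by simp [symInt]

theorem symInt_neg {q : K} (hq : q ≠ 0) (n : ℤ) : symInt q (-n) = -symInt q n := by
  unfold symInt
  split_ifs with h
  · rw [show n - 1 = (-n - 1) + 2 * n by ring, zpow_add₀ hq, zpow_even_of_sq_eq_one h]
    push_cast; ring
  · rw [neg_neg, ← neg_div, neg_sub]

theorem symInt_sub {q : K} (hq : q ≠ 0) (a b : ℤ) :
    symInt q (a - b) = symInt q (a - 1) * symInt q b - symInt q a * symInt q (b - 1) := by
  rw [sub_eq_add_neg, symInt_add hq, show -b + 1 = -(b - 1) by ring, symInt_neg hq, symInt_neg hq]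
  ring

/-- The identity behind the recursion for the generating function of a single path. -/
theorem symInt_two_mul_add {q : K} (hq : q ≠ 0) (h2 : (2 : K) ≠ 0) (h s : ℤ) :
    symInt q (2 * (h + s)) =
      (q ^ (s + 2 * h) + q ^ (-(s + 2 * h))) / 2 * (2 * symInt q s) + symInt q (2 * h) := by
  rw [← mul_assoc, div_mul_cancel₀ _ h2]
  unfold symInt
  split_ifs with hs
  · have e1 : q ^ (s + 2 * h) * q ^ (s - 1) = q ^ (2 * (h + s) - 1) := by
      rw [← zpow_add₀ hq]; congr 1; ring
    have e2 : q ^ (-(s + 2 * h)) * q ^ (s - 1) = q ^ (2 * (h + s) - 1) := by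
      rw [← zpow_add₀ hq, show 2 * (h + s) - 1 = -(s + 2 * h) + (s - 1) + 2 * (2 * h + s) by ring,
        zpow_add₀ hq _ (2 * (2 * h + s)), zpow_even_of_sq_eq_one hs, mul_one]
    have e3 : q ^ (2 * h - 1) = q ^ (2 * (h + s) - 1) := by
      rw [show 2 * (h + s) - 1 = 2 * h - 1 + 2 * s by ring, zpow_add₀ hq _ (2 * s),
        zpow_even_of_sq_eq_one hs, mul_one]
    push_cast
    linear_combination (-s : K) * e1 - (s : K) * e2 - (2 * h : K) * e3
  · have := sub_inv_ne_zero_of_sq_ne_one hq hs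
    rw [mul_div_assoc', ← add_div]
    congr 1
    simp only [mul_add, neg_add, two_mul, zpow_add₀ hq, zpow_neg]
    have := zpow_ne_zero h hq
    have := zpow_ne_zero s hq
    field_simp
    ring

theorem symInt_natCast {q : K} (hq : q ≠ 0) (n : ℕ) :
    symInt q n = q ^ (1 - n : ℤ) * qInt (q ^ 2) n := by
  unfold symInt qInt
  split_ifs with h
  · rw [show (n : ℤ) - 1 = (1 - n) + 2 * (n - 1) by ring, zpow_add₀ hq, zpow_even_of_sq_eq_one h]
    simp [h, mul_comm]
  · have := sub_inv_ne_zero_of_sq_ne_one hq h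
    rw [div_eq_iff this, geom_sum_eq h, zpow_sub₀ hq, zpow_neg, zpow_natCast, zpow_one, ← pow_mul,
      mul_comm 2 n, pow_mul]
    have := pow_ne_zero n hq
    have := sub_ne_zero.2 h
    field_simp

theorem symInt_natCast_ne_zero {q : K} (hq : q ≠ 0) (hqInt : ∀ k : ℕ, 0 < k → qInt (q ^ 2) k ≠ 0)
    {n : ℕ} (hn : 0 < n) : symInt q n ≠ 0 := by
  rw [symInt_natCast hq]
  exact mul_ne_zero (zpow_ne_zero _ hq) (hqInt n hn)

theorem symInt_ne_zero {q : K} (hq : q ≠ 0) (hqInt : ∀ k : ℕ, 0 < k → qInt (q ^ 2) k ≠ 0)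
    {n : ℤ} (hn : 0 < n) : symInt q n ≠ 0 := by
  lift n to ℕ using hn.le
  exact symInt_natCast_ne_zero hq hqInt (by exact_mod_cast hn)

/-- The generating function of the lattice paths with `h` horizontal and `s` vertical lozenges
that end at the `j`-axis. -/
noncomputable def stepGF (q : K) (h : ℤ) (s : ℕ) : K :=
  ∏ i ∈ range s, symInt q (2 * (h + i + 1)) / (2 * symInt q (i + 1))

theorem stepGF_succ {q : K} (hq : q ≠ 0) (h2 : (2 : K) ≠ 0)
    (hqInt : ∀ k : ℕ, 0 < k → qInt (q ^ 2) k ≠ 0) (h : ℤ) (s : ℕ) :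
    stepGF q h (s + 1) =
      (q ^ (s + 1 + 2 * h) + q ^ (-(s + 1 + 2 * h))) / 2 * stepGF q h s
        + stepGF q (h - 1) (s + 1) := by
  have h3 : symInt q ((s : ℤ) + 1) ≠ 0 := symInt_ne_zero hq hqInt (by omega)
  have e : stepGF q (h - 1) (s + 1) = stepGF q h s * (symInt q (2 * h) / (2 * symInt q (s + 1))) := by
    simp only [stepGF, prod_div_distrib]
    rw [prod_range_succ' (fun i : ℕ => symInt q (2 * (h - 1 + i + 1))),
      prod_range_succ (fun i : ℕ => 2 * symInt q ((i : ℤ) + 1))]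
    have : ∀ i : ℕ, symInt q (2 * (h - 1 + ((i + 1 : ℕ) : ℤ) + 1)) = symInt q (2 * (h + i + 1)) := by
      intro i; congr 1; push_cast; ring
    simp only [this]
    rw [show 2 * (h - 1 + ((0 : ℕ) : ℤ) + 1) = 2 * h by push_cast; ring]
    rw [mul_div_mul_comm]
  rw [e, stepGF, prod_range_succ, ← stepGF]
  have key := symInt_two_mul_add hq h2 h (s + 1)
  rw [show h + (s : ℤ) + 1 = h + (s + 1) by ring, key]
  field_simp

theorem stepGF_eq_zero {q : K} {h : ℤ} {s : ℕ} (hh : h < 0) (hs : 0 ≤ h + s) :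
    stepGF q h s = 0 := by
  refine prod_eq_zero (i := (-h - 1).toNat) (mem_range.2 (by omega)) ?_
  rw [show 2 * (h + ((-h - 1).toNat : ℤ) + 1) = 0 by omega, symInt_zero, zero_div]

/-- The generating function of the lattice paths starting at the right edge of the down-pointing
triangle `(2 * t + j, j)` and ending at the left edge of the bump `k`. Paths that have reached the
`j`-axis are frozen. -/
noncomputable def pathGF (q : K) (t j : ℤ) (k : ℕ) : K :=
  if 2 * t + j ≤ 0 then if j = 2 * k - 2 then 1 else 0
  else if j ≤ 2 * k - 2 ∧ 0 ≤ t + j - k + 1 then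
    stepGF q (t + j - k + 1) (2 * (k : ℤ) - 2 - j).toNat else 0

theorem pathGF_of_nonpos (q : K) {t j : ℤ} (k : ℕ) (h : 2 * t + j ≤ 0) :
    pathGF q t j k = if j = 2 * k - 2 then 1 else 0 := if_pos h

theorem pathGF_of_nonneg (q : K) {t j : ℤ} (k : ℕ) (h : -1 ≤ 2 * t + j) :
    pathGF q t j k = if j ≤ 2 * k - 2 ∧ 0 ≤ t + j - k + 1 then
      stepGF q (t + j - k + 1) (2 * (k : ℤ) - 2 - j).toNat else 0 := by
  unfold pathGF
  split_ifs with h1 h2 h3 h3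
  · subst h2; simp [stepGF]
  · omega
  · omega
  all_goals rfl

theorem pathGF_of_lt (q : K) {t j : ℤ} {k : ℕ} (h : 2 * (k : ℤ) - 2 < j) : pathGF q t j k = 0 := by
  unfold pathGF
  split_ifs <;> first | rfl | omega

theorem pathGF_frozen (q : K) {t j : ℤ} (k : ℕ) (h : 2 * t + j ≤ 0) :
    pathGF q t j k = pathGF q (t - 1) j k := by
  rw [pathGF_of_nonpos q k h, pathGF_of_nonpos q k (by omega)]

theorem pathGF_rec {q : K} (hq : q ≠ 0) (h2 : (2 : K) ≠ 0)
    (hqInt : ∀ k : ℕ, 0 < k → qInt (q ^ 2) k ≠ 0) {t j : ℤ} (k : ℕ) (h : 1 ≤ 2 * t + j) :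
    pathGF q t j k = pathGF q (t - 1) j k +
      (q ^ (2 * t + j) + q ^ (-(2 * t + j))) / 2 * pathGF q (t - 1) (j + 1) k := by
  rw [pathGF_of_nonneg q k (by omega), pathGF_of_nonneg q k (by omega),
    pathGF_of_nonneg q k (by omega)]
  rcases lt_trichotomy (2 * (k : ℤ) - 2) j with h1 | h1 | h1
  · simp [not_le.2 h1, show ¬ (j + 1 ≤ 2 * (k : ℤ) - 2) by omega]
  · rw [if_pos ⟨by omega, by omega⟩, if_pos ⟨by omega, by omega⟩, if_neg (by omega)]
    simp [h1, stepGF]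
  · obtain ⟨s, hs⟩ : ∃ s : ℕ, j = 2 * (k : ℤ) - 2 - (s + 1) := ⟨(2 * (k : ℤ) - 2 - j - 1).toNat, by omega⟩
    subst hs
    rw [show t - 1 + (2 * (k : ℤ) - 2 - (s + 1) + 1) - k + 1 = t + (2 * (k : ℤ) - 2 - (s + 1)) - k + 1 by ring,
      show t - 1 + (2 * (k : ℤ) - 2 - (s + 1)) - k + 1 = t + (2 * (k : ℤ) - 2 - (s + 1)) - k + 1 - 1 by ring,
      show (2 * (k : ℤ) - 2 - (2 * (k : ℤ) - 2 - (s + 1))).toNat = s + 1 by omega,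
      show (2 * (k : ℤ) - 2 - (2 * (k : ℤ) - 2 - (s + 1) + 1)).toNat = s by omega]
    rcases lt_trichotomy (t + (2 * (k : ℤ) - 2 - (s + 1)) - k + 1) 0 with h3 | h3 | h3
    · rw [if_neg (by omega), if_neg (by omega), if_neg (by omega)]; simp
    · rw [if_pos (by omega), if_neg (by omega), if_pos (by omega), stepGF_succ hq h2 hqInt,
        stepGF_eq_zero (h := _ - 1) (by omega) (by omega)]
      rw [show 2 * t + (2 * (k : ℤ) - 2 - (s + 1)) =
        s + 1 + 2 * (t + (2 * (k : ℤ) - 2 - (s + 1)) - k + 1) by ring]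
      ring
    · rw [if_pos (by omega), if_pos (by omega), if_pos (by omega), stepGF_succ hq h2 hqInt]
      rw [show 2 * t + (2 * (k : ℤ) - 2 - (s + 1)) =
        s + 1 + 2 * (t + (2 * (k : ℤ) - 2 - (s + 1)) - k + 1) by ring]
      ring

end Brackets

section Slices

/-- The condition describing the region `A_{x,d}(b_1, …, b_m)` by inequalities. -/
def IsRegionA (x d m : ℕ) (b : Fin m → ℕ) (R : Finset Triangle) : Prop :=
  ∀ i j : ℤ, (i, j) ∈ R ↔ 1 ≤ i ∧ -1 ≤ j ∧ j ≤ 2 * d - 2 ∧ i + j + 1 ≤ 2 * ((x : ℤ) + d) ∧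
    i - j ≤ 2 * ((x : ℤ) + d - m) + 2 ∧ (i = 1 → Even j → ∃ r, j = 2 * (b r : ℤ) - 2)

/-- The part of the region `R` still to be tiled after the paths `r ≥ k` have crossed the strip
between the lines `i - j = 2 * t` and `i - j = 2 * (t - 1)`, where `p r` is the current height of
the path `r`. -/
def sliceRegion {m : ℕ} (R : Finset Triangle) (p : Fin m → ℤ) (t : ℤ) (k : ℕ) : Finset Triangle :=
  R.filter fun u => u.1 - u.2 ≤ 2 * t - 2 ∨
    (u.1 - u.2 = 2 * t - 1 ∧ ∀ r : Fin m, k ≤ r → p r ≠ u.2) ∨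
    (u.1 - u.2 = 2 * t ∧ ∃ r : Fin m, (r : ℕ) < k ∧ p r = u.2)

theorem mem_sliceRegion {m : ℕ} {R : Finset Triangle} {p : Fin m → ℤ} {t : ℤ} {k : ℕ} {i j : ℤ} :
    (i, j) ∈ sliceRegion R p t k ↔ (i, j) ∈ R ∧ (i - j ≤ 2 * t - 2 ∨
      (i - j = 2 * t - 1 ∧ ∀ r : Fin m, k ≤ r → p r ≠ j) ∨
      (i - j = 2 * t ∧ ∃ r : Fin m, (r : ℕ) < k ∧ p r = j)) := mem_filter

variable {K : Type*} [Field K]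

/-- The matrix of the path generating functions for the paths in `sliceRegion`. -/
noncomputable def pathMatrix {m : ℕ} (q : K) (b : Fin m → ℕ) (p : Fin m → ℤ) (t : ℤ) (k : ℕ) :
    Matrix (Fin m) (Fin m) K :=
  Matrix.of fun r i => pathGF q (if (r : ℕ) < k then t else t - 1) (p r) (b i)

/-- The positions that the paths can have in the course of the slicing. -/
structure Admissible (x d : ℕ) {m : ℕ} (b : Fin m → ℕ) (t : ℤ) (k : ℕ) (p : Fin m → ℤ) : Prop where
  strictMono : StrictMono p
  neg_one_le : ∀ r, -1 ≤ p r
  le_top : ∀ r, p r ≤ 2 * d - 2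
  add_le : ∀ r, p r + t ≤ x + d
  add_lt : ∀ r : Fin m, (r : ℕ) < k → p r + t < x + d
  frozen : ∀ i, 2 * t + 2 * (b i : ℤ) - 2 ≤ 0 → ∃ r, p r = 2 * b i - 2

variable {x d m : ℕ} {b : Fin m → ℕ} {R : Finset Triangle}

theorem tgf_sliceRegion_base {q : K} (hR : IsRegionA x d m b R) (hb : StrictMono b)
    (hbd : ∀ r, b r ≤ d) {p : Fin m → ℤ} (hp : Admissible x d b (1 - d) m p) :
    tgf (wt1 q) (sliceRegion R p (1 - d) m) = (pathMatrix q b p (1 - d) m).det := by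
  have h1 : sliceRegion R p (1 - d) m = ∅ := by
    refine eq_empty_of_forall_notMem ?_
    rintro ⟨i, j⟩ h
    rw [mem_sliceRegion, hR] at h
    omega
  have h2 : p = fun i => 2 * (b i : ℤ) - 2 := by
    choose f hf using fun i => hp.frozen i (by have := hbd i; omega)
    have hmono : StrictMono fun i => 2 * (b i : ℤ) - 2 := fun i j hij => by
      have := hb hij
      simp only; omega
    refine (hp.strictMono.range_inj hmono).1 ?_
    have hfi : Function.Injective f := fun i j hij => hmono.injective (by
      simp only [← hf, hij])
    have hfs := Finite.surjective_of_injective hfi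
    ext y
    constructor
    · rintro ⟨r, rfl⟩
      obtain ⟨i, rfl⟩ := hfs r
      exact ⟨i, (hf i).symm⟩
    · rintro ⟨i, rfl⟩
      exact ⟨f i, hf i⟩
  have h3 : pathMatrix q b p (1 - d) m = 1 := by
    ext r i
    have := hp.le_top r
    rw [pathMatrix, Matrix.of_apply, if_pos r.2, pathGF_of_nonpos q _ (by omega), Matrix.one_apply]
    refine if_congr ?_ rfl rfl
    rw [h2, ← hb.injective.eq_iff]
    simp only
    omega
  rw [h1, h3, tgf_empty, Matrix.det_one]

theorem tgf_sliceRegion_zero {q : K} (hR : IsRegionA x d m b R) (hbd : ∀ r, b r ≤ d)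
    (hb1 : ∀ r, 1 ≤ b r) {t : ℤ} (ht : t ≤ x + d - m + 1)
    (ih : ∀ p, Admissible x d b (t - 1) m p →
      tgf (wt1 q) (sliceRegion R p (t - 1) m) = (pathMatrix q b p (t - 1) m).det)
    {p : Fin m → ℤ} (hp : Admissible x d b t 0 p) :
    tgf (wt1 q) (sliceRegion R p t 0) = (pathMatrix q b p t 0).det := by
  by_cases hfr : ∀ i, 2 * (t - 1) + 2 * (b i : ℤ) - 2 ≤ 0 → ∃ r, p r = 2 * b i - 2
  · have h1 : pathMatrix q b p t 0 = pathMatrix q b p (t - 1) m := by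
      ext r i
      simp [pathMatrix]
    rw [h1, ← ih p ⟨hp.strictMono, hp.neg_one_le, hp.le_top,
      fun r => by have := hp.add_le r; omega, fun r _ => by have := hp.add_le r; omega, hfr⟩]
    have hleft : ∀ i j : ℤ, i - j = 2 * t - 1 → (∀ r, p r ≠ j) →
        ((i, j) ∈ R ↔ (i - 1, j) ∈ R) := by
      intro i j hij hpj
      rw [hR, hR]
      constructor
      · rintro ⟨a1, a2, a3, a4, a5, a6⟩
        have : i ≠ 1 := by
          intro hi
          obtain ⟨r, hr⟩ := a6 hi ⟨1 - t, by omega⟩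
          obtain ⟨r', hr'⟩ := hfr r (by omega)
          exact hpj r' (hr'.trans hr.symm)
        refine ⟨by omega, a2, a3, by omega, by omega, ?_⟩
        rintro hi ⟨y, hy⟩
        omega
      · rintro ⟨a1, a2, a3, a4, a5, a6⟩
        exact ⟨by omega, a2, a3, by omega, by omega, fun hi => by omega⟩
    rw [tgf_sdiff_forced q ((sliceRegion R p t 0).filter fun u => u.1 - u.2 = 2 * t - 1)]
    · congr 1
      ext ⟨i, j⟩
      simp only [mem_sdiff, mem_union, mem_filter, mem_image, mem_sliceRegion, Prod.exists,
        Prod.mk.injEq, not_lt_zero, false_and, exists_false, and_false, or_false, zero_le,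
        true_imp_iff]
      constructor
      · rintro ⟨⟨h1, h2⟩, h3⟩
        push Not at h3
        refine ⟨h1, ?_⟩
        rcases h2 with h2 | ⟨h2, h4⟩
        · rcases lt_or_eq_of_le h2 with h5 | h5
          · rcases lt_or_eq_of_le (show i - j ≤ 2 * t - 3 by omega) with h6 | h6
            · left; omega
            · right; left
              exact ⟨by omega, fun r hr => absurd r.2 (by omega)⟩
          · right; right
            refine ⟨by omega, ?_⟩
            by_contra! h6
            have h7 : ∀ r, p r ≠ j := fun r => h6 r r.2
            have h8 : (i + 1, j) ∈ R := by
              rw [hleft _ _ (by omega) h7]; simpa using h1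
            refine h3.2 (i + 1) j ⟨⟨h8, Or.inr ⟨by omega, h7⟩⟩, by omega⟩ (by omega) rfl
        · exact absurd h2 (h3.1 ⟨h1, Or.inr ⟨h2, h4⟩⟩)
      · rintro ⟨h1, h2⟩
        refine ⟨⟨h1, by omega⟩, ?_⟩
        rintro (⟨-, h3⟩ | ⟨a, a', ⟨⟨h3, h4⟩, h5⟩, rfl, rfl⟩)
        · omega
        · rcases h4 with h4 | ⟨-, h4⟩
          · omega
          · rcases h2 with h2 | ⟨h2, -⟩ | ⟨-, r, -, hr⟩
            · omega
            · omega
            · exact h4 r hr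
    · rintro ⟨i, j⟩ hu
      rw [mem_filter] at hu
      obtain ⟨hu, hij⟩ := hu
      simp only at hij
      have hu' := mem_sliceRegion.1 hu
      have hpj : ∀ r, p r ≠ j := by
        rcases hu'.2 with h | ⟨-, h⟩ | ⟨h, -⟩
        · omega
        · exact fun r => h r (Nat.zero_le _)
        · omega
      refine ⟨hu, ⟨j + t - 1, by simp only; omega⟩, ?_, ?_, ?_⟩
      · rw [mem_sliceRegion]; omega
      · rw [mem_sliceRegion]
        rintro ⟨-, h | ⟨h, -⟩ | ⟨-, r, hr, -⟩⟩
        · omega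
        · omega
        · exact absurd hr (Nat.not_lt_zero _)
      · rw [mem_sliceRegion]
        exact ⟨(hleft i j hij hpj).1 hu'.1, Or.inl (by simp only; omega)⟩
  · push Not at hfr
    obtain ⟨i, hi, hpi⟩ := hfr
    have hi2 : 2 * t + 2 * (b i : ℤ) - 4 = 0 := by
      by_contra h
      obtain ⟨r, hr⟩ := hp.frozen i (by omega)
      exact hpi r hr
    have hbump : (1, 2 * (b i : ℤ) - 2) ∈ sliceRegion R p t 0 := by
      rw [mem_sliceRegion, hR]
      have := hbd i
      have := hb1 i
      exact ⟨⟨le_rfl, by omega, by omega, by omega, by omega, fun _ _ => ⟨i, rfl⟩⟩,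
        Or.inr (Or.inl ⟨by omega, fun r _ => hpi r⟩)⟩
    rw [tgf_eq_of_isUp q hbump ⟨b i - 1, by simp only; ring⟩, if_neg]
    · symm
      refine Matrix.det_eq_zero_of_column_eq_zero i fun r => ?_
      have := hpi r
      rw [pathMatrix, Matrix.of_apply, if_neg (Nat.not_lt_zero _)]
      rcases lt_or_gt_of_ne this with h | h
      · rw [pathGF_of_nonpos q _ (by omega), if_neg this]
      · exact pathGF_of_lt q h
    · rw [mem_sliceRegion, hR]; omega
    · rw [mem_sliceRegion]; omega
    · rw [mem_sliceRegion]
      rintro ⟨-, h | ⟨h, -⟩ | ⟨-, r, hr, -⟩⟩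
      · omega
      · omega
      · exact absurd hr (Nat.not_lt_zero _)

theorem tgf_sliceRegion_succ {q : K} (hq : q ≠ 0) (h2 : (2 : K) ≠ 0)
    (hqInt : ∀ k : ℕ, 0 < k → qInt (q ^ 2) k ≠ 0) (hR : IsRegionA x d m b R)
    (hbd : ∀ r, b r ≤ d) {t : ℤ} (ht : t ≤ x + d - m + 1) (k : Fin m)
    (ih : ∀ p, Admissible x d b t k p →
      tgf (wt1 q) (sliceRegion R p t k) = (pathMatrix q b p t k).det)
    {p : Fin m → ℤ} (hp : Admissible x d b t (k + 1) p) :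
    tgf (wt1 q) (sliceRegion R p t (k + 1)) = (pathMatrix q b p t (k + 1)).det := by
  have hpk : Admissible x d b t k p := ⟨hp.strictMono, hp.neg_one_le, hp.le_top, hp.add_le,
    fun r hr => hp.add_lt r (by omega), hp.frozen⟩
  have hlt := hp.add_lt k (Nat.lt_succ_self _)
  have hbot := hp.neg_one_le k
  have htop := hp.le_top k
  have hinj : ∀ r, p r = p k ↔ r = k := fun r => hp.strictMono.injective.eq_iff
  have hge : ∀ r : Fin m, (k : ℕ) ≤ r ↔ r = k ∨ (k : ℕ) + 1 ≤ r := fun r => by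
    rw [Fin.ext_iff]; omega
  have hlt' : ∀ r : Fin m, (r : ℕ) < k + 1 ↔ r = k ∨ (r : ℕ) < k := fun r => by
    rw [Fin.ext_iff]; omega
  rcases le_or_gt (2 * t + p k) 0 with hd | hd
  · have h1 : sliceRegion R p t (k + 1) = sliceRegion R p t k := by
      ext ⟨i, j⟩
      rw [mem_sliceRegion, mem_sliceRegion]
      refine and_congr_right fun hij => ?_
      have hi := ((hR i j).1 hij).1
      refine or_congr Iff.rfl (or_congr (and_congr_right fun h => ?_) (and_congr_right fun h => ?_))
      · simp only [hge, or_imp, forall_and, forall_eq]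
        exact ⟨fun h' => ⟨by omega, h'⟩, fun h' => h'.2⟩
      · simp only [hlt', or_and_right, exists_or, exists_eq_left]
        exact ⟨fun h' => h'.resolve_left (by omega), Or.inr⟩
    have h3 : pathMatrix q b p t (k + 1) = pathMatrix q b p t k := by
      ext r i
      simp only [pathMatrix, Matrix.of_apply]
      by_cases hr : r = k
      · subst hr
        rw [if_pos (Nat.lt_succ_self _), if_neg (lt_irrefl _), pathGF_frozen q _ hd]
      · simp only [hlt', hr, false_or]
    rw [h1, h3, ih p hpk]
  · have hδ : (2 * t + p k, p k) ∈ sliceRegion R p t (k + 1) := by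
      rw [mem_sliceRegion, hR]
      refine ⟨⟨by omega, hbot, htop, by omega, by omega, ?_⟩, Or.inr (Or.inr ⟨by ring, k, by omega, rfl⟩)⟩
      rintro h ⟨y, hy⟩
      omega
    set A := pathMatrix q b p t k with hA
    set w : K := (q ^ (2 * t + p k) + q ^ (-(2 * t + p k))) / 2 with hw
    set row : Fin m → K := fun i => pathGF q (t - 1) (p k + 1) (b i) with hrow
    have hAk : A k = fun i => pathGF q (t - 1) (p k) (b i) := by
      ext i
      simp [hA, pathMatrix]
    have hdet : (pathMatrix q b p t (k + 1)).det = A.det + w * (A.updateRow k row).det := by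
      have : pathMatrix q b p t (k + 1) = A.updateRow k (A k + w • row) := by
        ext r i
        by_cases hr : r = k
        · subst hr
          rw [Matrix.updateRow_self, hAk, pathMatrix, Matrix.of_apply, if_pos (Nat.lt_succ_self _),
            pathGF_rec hq h2 hqInt _ (by omega)]
          rfl
        · rw [Matrix.updateRow_ne hr, hA]
          simp only [pathMatrix, Matrix.of_apply, hlt', hr, false_or]
      rw [this, Matrix.det_updateRow_add, Matrix.det_updateRow_smul, Matrix.updateRow_eq_self]
    rw [hdet, tgf_eq_of_isDown q hδ ⟨t + p k, by simp only; ring⟩]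
    · congr 1
      · by_cases hu : (2 * t + p k - 1, p k) ∈ R
        · rw [if_pos, ← ih p hpk]
          · congr 1
            ext ⟨i, j⟩
            simp only [mem_sdiff, mem_sliceRegion, mem_insert, mem_singleton, Prod.mk.injEq]
            constructor
            · rintro ⟨⟨h1, h3⟩, h4⟩
              refine ⟨h1, h3.imp_right (Or.imp ?_ ?_)⟩
              · rintro ⟨h5, h6⟩
                refine ⟨h5, fun r hr => ?_⟩
                rcases (hge r).1 hr with rfl | hr
                · omega
                · exact h6 r hr
              · rintro ⟨h5, r, hr, hrj⟩
                refine ⟨h5, r, ?_, hrj⟩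
                rcases (hlt' r).1 hr with rfl | hr
                · omega
                · exact hr
            · rintro ⟨h1, h3⟩
              refine ⟨⟨h1, h3.imp_right (Or.imp ?_ ?_)⟩, ?_⟩
              · exact fun h => ⟨h.1, fun r hr => h.2 r (by omega)⟩
              · exact fun ⟨h, r, hr, hrj⟩ => ⟨h, r, by omega, hrj⟩
              · rintro (⟨rfl, rfl⟩ | ⟨rfl, rfl⟩)
                · rcases h3 with h | ⟨h, -⟩ | ⟨-, r, hr, hrj⟩
                  · omega
                  · omega
                  · rw [hinj] at hrj
                    subst hrj
                    exact lt_irrefl _ hr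
                · rcases h3 with h | ⟨-, h⟩ | ⟨h, -⟩
                  · omega
                  · exact h k le_rfl rfl
                  · omega
          · rw [mem_sliceRegion]
            refine ⟨hu, Or.inr (Or.inl ⟨by ring, fun r hr h => ?_⟩)⟩
            rw [hinj] at h
            subst h
            omega
        · rw [if_neg (fun h => hu (mem_sliceRegion.1 h).1)]
          symm
          refine Matrix.det_eq_zero_of_row_eq_zero k fun i => ?_
          rw [hAk]
          simp only
          rw [hR] at hu
          have h1 : 2 * t + p k ≤ 2 := by
            by_contra h
            exact hu ⟨by omega, hbot, htop, by omega, by omega, fun h => by omega⟩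
          rw [pathGF_of_nonpos q _ (by omega), if_neg]
          intro h
          exact hu ⟨by omega, hbot, htop, by omega, by omega, fun _ _ => ⟨i, h⟩⟩
      · by_cases hu : (2 * t + p k, p k + 1) ∈ R
        · by_cases hn : ∃ r, p r = p k + 1
          · obtain ⟨r, hr⟩ := hn
            have hkr : k < r := hp.strictMono.lt_iff_lt.1 (by omega)
            rw [if_neg]
            · rw [Matrix.det_zero_of_row_eq (ne_of_lt hkr), mul_zero]
              rw [Matrix.updateRow_self, Matrix.updateRow_ne (ne_of_gt hkr)]
              ext i
              rw [hA, pathMatrix, Matrix.of_apply, if_neg (by simpa using hkr.le), hr]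
            · rw [mem_sliceRegion]
              rintro ⟨-, h | ⟨-, h⟩ | ⟨h, -⟩⟩
              · omega
              · exact h r hkr hr
              · omega
          · push Not at hn
            have hu' := (hR _ _).1 hu
            set p' := Function.update p k (p k + 1) with hp'
            have hpk' : p' k = p k + 1 := Function.update_self ..
            have hpne : ∀ r, r ≠ k → p' r = p r := fun r hr => Function.update_of_ne hr _ _
            have hcase : ∀ r, r = k ∧ p' r = p k + 1 ∨ r ≠ k ∧ p' r = p r := fun r => by
              by_cases hr : r = k
              · left; rw [hr]; exact ⟨rfl, hpk'⟩
              · right; exact ⟨hr, hpne r hr⟩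
            have hadm : Admissible x d b t k p' := by
              refine ⟨fun r s hrs => ?_, fun r => ?_, fun r => ?_, fun r => ?_, fun r hr => ?_,
                fun i hi => ?_⟩
              · have h1 := hp.strictMono hrs
                have h3 := hn s
                rcases hcase r with ⟨rfl, e⟩ | ⟨-, e⟩ <;> rcases hcase s with ⟨rfl, e'⟩ | ⟨-, e'⟩ <;>
                  omega
              · have := hp.neg_one_le r
                rcases hcase r with ⟨rfl, e⟩ | ⟨-, e⟩ <;> omega
              · have := hp.le_top r
                rcases hcase r with ⟨rfl, e⟩ | ⟨-, e⟩ <;> omega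
              · have := hp.add_le r
                rcases hcase r with ⟨rfl, e⟩ | ⟨-, e⟩ <;> omega
              · have := hp.add_lt r (by omega)
                rcases hcase r with ⟨rfl, e⟩ | ⟨-, e⟩ <;> omega
              · obtain ⟨r, hr⟩ := hp.frozen i hi
                refine ⟨r, ?_⟩
                rcases hcase r with ⟨rfl, e⟩ | ⟨-, e⟩ <;> omega
            have hmat : A.updateRow k row = pathMatrix q b p' t k := by
              ext r i
              by_cases hr : r = k
              · subst hr
                rw [Matrix.updateRow_self, pathMatrix, Matrix.of_apply, if_neg (lt_irrefl _), hpk']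
              · rw [Matrix.updateRow_ne hr, hA]
                simp only [pathMatrix, Matrix.of_apply, hpne r hr]
            rw [if_pos, hmat, ← ih p' hadm]
            · congr 2
              ext ⟨i, j⟩
              simp only [mem_sdiff, mem_sliceRegion, mem_insert, mem_singleton, Prod.mk.injEq]
              constructor
              · rintro ⟨⟨h1, h3⟩, h4⟩
                refine ⟨h1, h3.imp_right (Or.imp ?_ ?_)⟩
                · rintro ⟨h5, h6⟩
                  refine ⟨h5, fun r hr => ?_⟩
                  rcases (hge r).1 hr with rfl | hr
                  · omega
                  · rw [hpne r (by rintro rfl; omega)]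
                    exact h6 r hr
                · rintro ⟨h5, r, hr, hrj⟩
                  rcases (hlt' r).1 hr with rfl | hr
                  · omega
                  · exact ⟨h5, r, hr, by rw [hpne r (by rintro rfl; omega)]; exact hrj⟩
              · rintro ⟨h1, h3⟩
                refine ⟨⟨h1, h3.imp_right (Or.imp ?_ ?_)⟩, ?_⟩
                · exact fun h => ⟨h.1, fun r hr => by
                    rw [← hpne r (by rintro rfl; omega)]; exact h.2 r (by omega)⟩
                · exact fun ⟨h, r, hr, hrj⟩ => ⟨h, r, by omega, by
                    rw [← hpne r (by rintro rfl; omega)]; exact hrj⟩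
                · rintro (⟨rfl, rfl⟩ | ⟨rfl, rfl⟩)
                  · rcases h3 with h | ⟨h, -⟩ | ⟨-, r, hr, hrj⟩
                    · omega
                    · omega
                    · rw [hpne r (by rintro rfl; omega), hinj] at hrj
                      subst hrj
                      exact lt_irrefl _ hr
                  · rcases h3 with h | ⟨-, h⟩ | ⟨h, -⟩
                    · omega
                    · exact h k le_rfl hpk'
                    · omega
            · rw [mem_sliceRegion]
              exact ⟨hu, Or.inr (Or.inl ⟨by ring, fun r _ => hn r⟩)⟩
        · rw [if_neg (fun h => hu (mem_sliceRegion.1 h).1)]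
          symm
          rw [Matrix.det_eq_zero_of_row_eq_zero k, mul_zero]
          intro i
          rw [Matrix.updateRow_self]
          simp only [hrow]
          by_cases h1 : 2 * (b i : ℤ) - 2 < p k + 1
          · exact pathGF_of_lt q h1
          · rw [hR] at hu
            by_cases h3 : 2 * t + p k = 1 ∧ p k + 1 ≤ 2 * d - 2
            · rw [pathGF_of_nonpos q _ (by omega), if_neg]
              intro h
              exact hu ⟨by omega, by omega, by omega, by omega, by omega, fun _ _ => ⟨i, h⟩⟩
            · by_cases h4 : p k + 1 ≤ 2 * d - 2
              · exact absurd ⟨by omega, by omega, by omega, by omega, by omega,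
                  fun h => by omega⟩ hu
              · have := hbd i
                omega
    · rw [mem_sliceRegion]; omega

theorem tgf_sliceRegion {q : K} (hq : q ≠ 0) (h2 : (2 : K) ≠ 0)
    (hqInt : ∀ k : ℕ, 0 < k → qInt (q ^ 2) k ≠ 0) (hR : IsRegionA x d m b R) (hb : StrictMono b)
    (hbd : ∀ r, b r ≤ d) (hb1 : ∀ r, 1 ≤ b r) {t : ℤ} (ht1 : 1 - d ≤ t) (ht : t ≤ x + d - m + 1) :
    ∀ p, Admissible x d b t m p →
      tgf (wt1 q) (sliceRegion R p t m) = (pathMatrix q b p t m).det := by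
  induction t, ht1 using Int.leInduction with
  | base => exact fun p hp => tgf_sliceRegion_base hR hb hbd hp
  | succ t _ ih =>
    have key : ∀ k : ℕ, k ≤ m → ∀ p, Admissible x d b (t + 1) k p →
        tgf (wt1 q) (sliceRegion R p (t + 1) k) = (pathMatrix q b p (t + 1) k).det := by
      intro k
      induction k with
      | zero =>
        exact fun _ p hp => tgf_sliceRegion_zero hR hbd hb1 ht
          (by rw [add_sub_cancel_right]; exact ih (by omega)) hp
      | succ k ihk =>
        exact fun hk p hp => tgf_sliceRegion_succ hq h2 hqInt hR hbd ht ⟨k, hk⟩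
          (ihk (by omega)) hp
    exact key m le_rfl

/-- The tiling generating function of the region as a determinant of path generating functions. -/
theorem tgf_eq_det {q : K} (hq : q ≠ 0) (h2 : (2 : K) ≠ 0)
    (hqInt : ∀ k : ℕ, 0 < k → qInt (q ^ 2) k ≠ 0) (hR : IsRegionA x d m b R) (hb : StrictMono b)
    (hbd : ∀ r, b r ≤ d) (hb1 : ∀ r, 1 ≤ b r) (hmd : m ≤ d) :
    tgf (wt1 q) R =
      (Matrix.of fun r i : Fin m => pathGF q (x + d - m + 1) ((r : ℤ) - 1) (b i)).det := by
  have hadm : Admissible x d b (x + d - m + 1) m fun r : Fin m => (r : ℤ) - 1 := by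
    refine ⟨fun r s hrs => ?_, fun r => ?_, fun r => ?_, fun r => ?_, fun r _ => ?_, fun i hi => ?_⟩
    · have : (r : ℕ) < s := hrs
      omega
    all_goals first
      | (have := r.2; omega)
      | (have := hb1 i; omega)
  have hreg : sliceRegion R (fun r : Fin m => (r : ℤ) - 1) (x + d - m + 1) m = R := by
    ext ⟨i, j⟩
    rw [mem_sliceRegion, and_iff_left_iff_imp, hR]
    rintro ⟨a1, a2, a3, a4, a5, -⟩
    rcases lt_trichotomy (i - j) (2 * (x + d - m + 1) - 1) with h | h | h
    · left; omega
    · right; left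
      exact ⟨h, fun r hr => absurd r.2 (by omega)⟩
    · right; right
      exact ⟨by omega, ⟨(j + 1).toNat, by omega⟩, by simp only; omega, by simp only; omega⟩
  rw [← hreg, tgf_sliceRegion hq h2 hqInt hR hb hbd hb1 (by omega) le_rfl _ hadm]
  congr 1
  ext r i
  rw [pathMatrix, Matrix.of_apply, Matrix.of_apply, if_pos r.2]

end Slices

section Determinant

variable {K : Type*} [Field K]

/-- A product of linear forms in two variables is a binary form. -/
theorem exists_coeff_prod_linear {ι : Type*} (s : Finset ι) (α β : ι → K) :
    ∃ c : ℕ → K, ∀ u v : K, ∏ t ∈ s, (α t * u + β t * v) =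
      ∑ k ∈ range (#s + 1), c k * (u ^ k * v ^ (#s - k)) := by
  classical
  induction s using Finset.induction_on with
  | empty => exact ⟨fun _ => 1, by simp⟩
  | insert a s ha ih =>
    obtain ⟨c, hc⟩ := ih
    refine ⟨fun k => (if k = 0 then 0 else α a * c (k - 1)) +
      (if k = #s + 1 then 0 else β a * c k), fun u v => ?_⟩
    rw [prod_insert ha, hc, card_insert_of_notMem ha]
    simp only [add_mul, sum_add_distrib]
    congr 1
    · rw [sum_range_succ' _ (#s + 1), if_pos rfl, zero_mul, add_zero, mul_sum]
      refine sum_congr rfl fun k hk => ?_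
      rw [if_neg (Nat.succ_ne_zero k), Nat.add_sub_cancel, Nat.add_sub_add_right]
      ring
    · rw [sum_range_succ _ (#s + 1), if_pos rfl, zero_mul, add_zero, mul_sum]
      refine sum_congr rfl fun k hk => ?_
      rw [mem_range] at hk
      rw [if_neg hk.ne, show #s + 1 - k = #s - k + 1 by omega]
      ring

/-- Determinants whose rows are products of linear forms factor as a constant times a
Vandermonde-type product. -/
theorem exists_det_prod_linear {m : ℕ} (α β : Fin m → ℕ → K) :
    ∃ C : K, ∀ u v : Fin m → K,
      (Matrix.of fun r i => ∏ t ∈ range (m - 1), (α r t * u i + β r t * v i)).det =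
        C * ∏ i, ∏ j ∈ Ioi i, (u j * v i - u i * v j) := by
  choose c hc using fun r : Fin m => exists_coeff_prod_linear (range (m - 1)) (α r) (β r)
  refine ⟨(Matrix.of fun r k : Fin m => c r k).det, fun u v => ?_⟩
  rw [← Matrix.det_projVandermonde, ← Matrix.det_transpose (Matrix.projVandermonde u v),
    ← Matrix.det_mul]
  congr 1
  ext r i
  have hm : m - 1 + 1 = m := Nat.sub_add_cancel (Nat.one_le_of_lt r.2)
  rw [Matrix.of_apply, hc, card_range, hm, Matrix.mul_apply, ← Fin.sum_univ_eq_sum_range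
    (fun k => c r k * (u i ^ k * v i ^ (m - 1 - k)))]
  refine sum_congr rfl fun k _ => ?_
  rw [Matrix.of_apply, Matrix.transpose_apply, Matrix.projVandermonde_apply, Fin.val_rev]
  congr 3
  omega

/-- A `q`-analogue of Krattenthaler's determinant. -/
theorem det_symInt {q : K} (hq : q ≠ 0) (hqInt : ∀ k : ℕ, 0 < k → qInt (q ^ 2) k ≠ 0) {m : ℕ}
    (B : ℕ → ℤ) (n : Fin m → ℤ) :
    (Matrix.of fun r i : Fin m => ∏ t ∈ range (m - 1),
        if t < (r : ℕ) then symInt q (n i - (t + 1)) else symInt q (B (t + 1) - n i)).det =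
      (∏ r : Fin m, ∏ t ∈ Ico (r : ℕ) (m - 1), symInt q (B (t + 1) - (r + 1))) *
        ∏ i, ∏ j ∈ Ioi i, symInt q (n j - n i) := by
  obtain ⟨C, hC⟩ := exists_det_prod_linear
    (fun (r : Fin m) t => if t < (r : ℕ) then symInt q (t + 1) else -symInt q (B (t + 1)))
    (fun (r : Fin m) t => if t < (r : ℕ) then -symInt q (t + 1 - 1) else symInt q (B (t + 1) - 1))
  have key : ∀ n : Fin m → ℤ, (Matrix.of fun r i : Fin m => ∏ t ∈ range (m - 1),
      if t < (r : ℕ) then symInt q (n i - (t + 1)) else symInt q (B (t + 1) - n i)).det =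
      C * ∏ i, ∏ j ∈ Ioi i, symInt q (n j - n i) := by
    intro n
    have e1 : ∀ i j, symInt q (n j - n i) =
        symInt q (n j - 1) * symInt q (n i) - symInt q (n i - 1) * symInt q (n j) := by
      intro i j
      rw [symInt_sub hq (n j) (n i)]; ring
    simp only [e1]
    rw [← hC (fun i => symInt q (n i - 1)) (fun i => symInt q (n i))]
    refine congrArg Matrix.det (Matrix.ext fun r i => ?_)
    simp only [Matrix.of_apply]
    refine prod_congr rfl fun t _ => ?_
    split_ifs
    · rw [symInt_sub hq]; ring
    · rw [← neg_sub, symInt_neg hq, symInt_sub hq]; ring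
  have h1 := key fun i => (i : ℤ) + 1
  have hpos : (∏ i : Fin m, ∏ j ∈ Ioi i, symInt q (((j : ℕ) : ℤ) + 1 - (((i : ℕ) : ℤ) + 1))) ≠ 0 :=
    prod_ne_zero_iff.2 fun i _ => prod_ne_zero_iff.2 fun j hj => symInt_ne_zero hq hqInt (by
      have : i < j := mem_Ioi.1 hj
      omega)
  rw [key n, mul_right_cancel₀ hpos (h1.symm.trans ?_)]
  have hv : ∏ i : Fin m, ∏ j ∈ Ioi i, symInt q (((j : ℕ) : ℤ) + 1 - (((i : ℕ) : ℤ) + 1)) =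
      ∏ j : Fin m, ∏ t ∈ range j, symInt q (((j : ℕ) : ℤ) + 1 - ((t : ℤ) + 1)) := by
    rw [prod_comm' (t' := univ) (s' := fun j => Iio j) (by simp)]
    refine prod_congr rfl fun j _ => ?_
    rw [← Nat.Iio_eq_range, ← Fin.map_valEmbedding_Iio, prod_map]
    rfl
  rw [Matrix.det_of_isUpperTriangular, hv, ← prod_mul_distrib]
  · refine prod_congr rfl fun r _ => ?_
    rw [Matrix.of_apply, ← prod_range_mul_prod_Ico _ (show (r : ℕ) ≤ m - 1 by omega), mul_comm]
    congr 1
    · exact prod_congr rfl fun t ht => if_neg (by simpa using (mem_Ico.1 ht).1)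
    · exact prod_congr rfl fun t ht => if_pos (mem_range.1 ht)
  · intro r i hri
    have hri' : (i : ℕ) < r := hri
    rw [Matrix.of_apply]
    refine prod_eq_zero (i := (i : ℕ)) (mem_range.2 (by omega)) ?_
    rw [if_pos hri', sub_self, symInt_zero]

end Determinant

section Evaluation

variable {K : Type*} [Field K]

/-- The product `{2} {4} ⋯ {2 n}` of symmetric `q`-integers. -/
noncomputable def symDoubleFact (q : K) (n : ℕ) : K := ∏ r ∈ range n, symInt q (2 * ((r : ℤ) + 1))

/-- The symmetric `q`-factorial. -/
noncomputable def symFact (q : K) (n : ℕ) : K := ∏ r ∈ range n, symInt q ((r : ℤ) + 1)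

theorem symDoubleFact_ne_zero {q : K} (hq : q ≠ 0)
    (hqInt : ∀ k : ℕ, 0 < k → qInt (q ^ 2) k ≠ 0) (n : ℕ) : symDoubleFact q n ≠ 0 :=
  prod_ne_zero_iff.2 fun _ _ => symInt_ne_zero hq hqInt (by omega)

theorem symFact_ne_zero {q : K} (hq : q ≠ 0)
    (hqInt : ∀ k : ℕ, 0 < k → qInt (q ^ 2) k ≠ 0) (n : ℕ) : symFact q n ≠ 0 :=
  prod_ne_zero_iff.2 fun _ _ => symInt_ne_zero hq hqInt (by omega)

theorem symDoubleFact_add (q : K) (n k : ℕ) : symDoubleFact q (n + k) =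
    symDoubleFact q n * ∏ i ∈ range k, symInt q (2 * ((n : ℤ) + i + 1)) := by
  rw [symDoubleFact, prod_range_add, symDoubleFact]
  congr 1

theorem symFact_add (q : K) (n k : ℕ) : symFact q (n + k) =
    symFact q n * ∏ i ∈ range k, symInt q (((n + k : ℕ) : ℤ) - i) := by
  rw [symFact, prod_range_add, symFact]
  congr 1
  rw [← prod_range_reflect]
  refine prod_congr rfl fun i hi => ?_
  rw [mem_range] at hi
  congr 1
  omega

theorem pathGF_start {q : K} (hq : q ≠ 0) (h2 : (2 : K) ≠ 0)
    (hqInt : ∀ k : ℕ, 0 < k → qInt (q ^ 2) k ≠ 0) {c y m r k : ℕ} (hr : r < m) (hk : 1 ≤ k)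
    (hy : y + k = c + m) :
    pathGF q ((c : ℤ) + 1) ((r : ℤ) - 1) k = 2 ^ (r + 1) *
      (symDoubleFact q (c + k) / (symDoubleFact q y * (2 ^ (2 * k) * symFact q (2 * k - 1))) *
      ∏ t ∈ range (m - 1), if t < r then symInt q (2 * (k : ℤ) - ((t : ℤ) + 1))
        else symInt q (2 * ((c : ℤ) + ((t + 1 : ℕ) : ℤ) + 1) - 2 * (k : ℤ))) := by
  rw [pathGF_of_nonneg q _ (by omega)]
  split_ifs with h
  · obtain ⟨h, hh⟩ : ∃ h : ℕ, c + 1 + r = h + k := ⟨c + 1 + r - k, by omega⟩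
    obtain ⟨s, hs⟩ : ∃ s : ℕ, 2 * k = s + r + 1 := ⟨2 * k - 1 - r, by omega⟩
    rw [show (c : ℤ) + 1 + (r - 1) - k + 1 = h by omega,
      show (2 * (k : ℤ) - 2 - (r - 1)).toNat = s by omega, show 2 * k - 1 = s + r by omega,
      show c + k = h + s by omega, show y = h + (m - 1 - r) by omega, hs, symDoubleFact_add,
      symDoubleFact_add, symFact_add, ← prod_range_mul_prod_Ico _ (show r ≤ m - 1 by omega),
      prod_Ico_eq_prod_range]
    have e1 : ∏ t ∈ range r, (if t < r then symInt q (2 * (k : ℤ) - ((t : ℤ) + 1))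
        else symInt q (2 * ((c : ℤ) + ((t + 1 : ℕ) : ℤ) + 1) - 2 * (k : ℤ))) =
        ∏ i ∈ range r, symInt q (((s + r : ℕ) : ℤ) - i) := by
      refine prod_congr rfl fun t ht => ?_
      rw [if_pos (mem_range.1 ht)]
      congr 1
      omega
    have e2 : ∏ t ∈ range (m - 1 - r), (if r + t < r then symInt q (2 * (k : ℤ) - (((r + t : ℕ) : ℤ) + 1))
        else symInt q (2 * ((c : ℤ) + ((r + t + 1 : ℕ) : ℤ) + 1) - 2 * (k : ℤ))) =
        ∏ i ∈ range (m - 1 - r), symInt q (2 * ((h : ℤ) + i + 1)) := by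
      refine prod_congr rfl fun t _ => ?_
      rw [if_neg (by omega)]
      congr 1
      omega
    have e3 : stepGF q h s = (∏ i ∈ range s, symInt q (2 * ((h : ℤ) + i + 1))) /
        (2 ^ s * symFact q s) := by
      rw [stepGF, prod_div_distrib, prod_mul_distrib, prod_const, card_range, symFact]
    rw [e1, e2, e3]
    have n1 := symDoubleFact_ne_zero hq hqInt h
    have n2 := symFact_ne_zero hq hqInt s
    have n3 : ∏ i ∈ range r, symInt q (((s + r : ℕ) : ℤ) - i) ≠ 0 :=
      prod_ne_zero_iff.2 fun i hi => symInt_ne_zero hq hqInt (by rw [mem_range] at hi; omega)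
    have n4 : ∏ i ∈ range (m - 1 - r), symInt q (2 * ((h : ℤ) + i + 1)) ≠ 0 :=
      prod_ne_zero_iff.2 fun i hi => symInt_ne_zero hq hqInt (by omega)
    rw [show s + r + 1 = s + (r + 1) by ring, pow_add 2 s]
    field_simp
  · rw [eq_comm, mul_eq_zero, mul_eq_zero]
    right; right
    by_cases h1 : (r : ℤ) - 1 ≤ 2 * k - 2
    · refine prod_eq_zero (i := k - c - 2) (mem_range.2 (by omega)) ?_
      rw [if_neg (by omega), show 2 * ((c : ℤ) + ((k - c - 2 + 1 : ℕ) : ℤ) + 1) - 2 * k = 0 by omega,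
        symInt_zero]
    · refine prod_eq_zero (i := 2 * k - 1) (mem_range.2 (by omega)) ?_
      rw [if_pos (by omega), show 2 * (k : ℤ) - (((2 * k - 1 : ℕ) : ℤ) + 1) = 0 by omega,
        symInt_zero]

theorem prod_fin_Ioi {M : Type*} [CommMonoid M] (m : ℕ) (f : ℕ → ℕ → M) :
    ∏ i : Fin m, ∏ j ∈ Ioi i, f i j = ∏ j ∈ range m, ∏ i ∈ range j, f i j := by
  rw [prod_comm' (t' := univ) (s' := fun j => Iio j) (by simp), ← Fin.prod_univ_eq_prod_range
    (fun j => ∏ i ∈ range j, f i j)]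
  refine prod_congr rfl fun j _ => ?_
  rw [← Nat.Iio_eq_range, ← Fin.map_valEmbedding_Iio, prod_map]
  rfl

@[to_additive]
theorem prod_Icc_eq_prod_range_succ {M : Type*} [CommMonoid M] (m : ℕ) (f : ℕ → M) :
    ∏ i ∈ Icc 1 m, f i = ∏ i ∈ range m, f (i + 1) := by
  rw [range_eq_Ico, prod_Ico_add' f 0 m 1, zero_add]
  rfl

theorem prod_Icc_Icc {M : Type*} [CommMonoid M] (m : ℕ) (f : ℕ → ℕ → M) :
    ∏ i ∈ Icc 1 m, ∏ j ∈ Icc (i + 1) m, f i j =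
      ∏ j ∈ range m, ∏ i ∈ range j, f (i + 1) (j + 1) := by
  rw [prod_comm' (t' := Icc 1 m) (s' := fun j => Icc 1 (j - 1))
    (by intro i j; simp only [mem_Icc]; omega), prod_Icc_eq_prod_range_succ]
  refine prod_congr rfl fun j _ => ?_
  rw [prod_Icc_eq_prod_range_succ, Nat.add_sub_cancel]

theorem prod_staircase {M : Type*} [CommMonoid M] (m : ℕ) (f : ℕ → M) :
    ∏ i ∈ Icc 1 ((m + 1) / 2), ∏ j ∈ Icc 1 (2 * m + 3 - 4 * i), f (2 * i + j - 1) =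
      ∏ r ∈ range (m + 1), ∏ t ∈ Ico r m, f (2 * (t + 1) - r) := by
  rw [prod_sigma', prod_sigma']
  refine prod_bij'
    (fun a _ => ⟨2 * (min (2 * a.1 + a.2 - 1) (m + 1) - a.1) - (2 * a.1 + a.2 - 1),
      min (2 * a.1 + a.2 - 1) (m + 1) - a.1 - 1⟩)
    (fun a _ => ⟨min (2 * (a.2 + 1) - a.1) (m + 1) - (a.2 + 1),
      2 * (a.2 + 1) - a.1 + 1 - 2 * (min (2 * (a.2 + 1) - a.1) (m + 1) - (a.2 + 1))⟩) ?_ ?_ ?_ ?_ ?_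
  · rintro ⟨i, j⟩ h
    simp only [mem_sigma, mem_Icc, mem_range, mem_Ico] at h ⊢
    omega
  · rintro ⟨i, j⟩ h
    simp only [mem_sigma, mem_Icc, mem_range, mem_Ico] at h ⊢
    omega
  · rintro ⟨i, j⟩ h
    simp only [mem_sigma, mem_Icc] at h
    simp only [Sigma.mk.injEq, heq_eq_eq]
    omega
  · rintro ⟨i, j⟩ h
    simp only [mem_sigma, mem_range, mem_Ico] at h
    simp only [Sigma.mk.injEq, heq_eq_eq]
    omega
  · rintro ⟨i, j⟩ h
    simp only [mem_sigma, mem_Icc] at h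
    simp only
    congr 1
    omega

theorem prod_zpow_eq_zpow_sum {q : K} (hq : q ≠ 0) {ι : Type*} (s : Finset ι) (f : ι → ℤ) :
    ∏ i ∈ s, q ^ f i = q ^ ∑ i ∈ s, f i := by
  classical
  induction s using Finset.induction_on with
  | empty => simp
  | insert a s ha ih => rw [prod_insert ha, sum_insert ha, zpow_add₀ hq, ih]

theorem qInt_sq_eq {q : K} (hq : q ≠ 0) (n : ℕ) :
    qInt (q ^ 2) n = q ^ ((n : ℤ) - 1) * symInt q n := by
  rw [symInt_natCast hq, ← mul_assoc, ← zpow_add₀ hq]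
  simp

theorem two_mul_angle (a : ℤ) (n : ℕ) : 2 * angle (a + n - 1) a = n * (2 * a + n - 1) := by
  induction n with
  | zero => simp [angle]
  | succ n ih =>
    have : Icc a (a + ((n + 1 : ℕ) : ℤ) - 1) = insert (a + (n : ℤ)) (Icc a (a + n - 1)) := by
      ext y
      simp only [mem_Icc, mem_insert]
      omega
    rw [angle, this, sum_insert (by simp), mul_add, ← angle, ih]
    push_cast
    ring

/-- The bookkeeping of the powers of `q`. -/
theorem exponent_identity (c : ℤ) (m : ℕ) (L : ℕ → ℤ) :
    ∑ i ∈ range m, (2 * L i - (i + 1)) * (4 * c + 1 + 3 * (i + 1) - 2 * L i) =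
      2 * (∑ j ∈ range m, ∑ i ∈ range j, (2 * (L j - L i) - 1))
      - ∑ i ∈ range m, (2 * L i - 1) * (2 * L i - 2)
      + 2 * (∑ r ∈ range (m + 1), ∑ t ∈ Ico r m, (2 * c + (2 * ((t : ℤ) + 1) - r) - 1))
      + 2 * ∑ i ∈ range m, (L i - (i + 1)) * (4 * c + 2 * m) := by
  have h : ∀ m : ℕ, ∑ r ∈ range (m + 1), ∑ t ∈ Ico r m, (2 * c + (2 * ((t : ℤ) + 1) - r) - 1) =
      ∑ t ∈ range m, ∑ r ∈ range (t + 1), (2 * c + (2 * ((t : ℤ) + 1) - r) - 1) := fun m =>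
    sum_comm' (by intro r t; simp only [mem_range, mem_Ico]; omega)
  have hid : ∀ n : ℕ, 2 * ∑ i ∈ range n, (i : ℤ) = n * (n - 1) := by
    intro n
    induction n with
    | zero => simp
    | succ n ih => rw [sum_range_succ, mul_add, ih]; push_cast; ring
  rw [h]
  induction m with
  | zero => simp
  | succ m ih =>
    have e : ∑ i ∈ range m, (L i - ((i : ℤ) + 1)) * (4 * c + 2 * ((m + 1 : ℕ) : ℤ)) =
        ∑ i ∈ range m, (L i - ((i : ℤ) + 1)) * (4 * c + 2 * m) +
          2 * (∑ i ∈ range m, L i - ∑ i ∈ range m, (i : ℤ) - m) := by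
      rw [← sum_mul, ← sum_mul, sum_sub_distrib, sum_add_distrib]
      simp only [sum_const, card_range]
      push_cast
      ring
    simp only [sum_range_succ _ m, e, ih]
    have e1 : ∑ i ∈ range m, (2 * (L m - L i) - 1) = m * (2 * L m - 1) - 2 * ∑ i ∈ range m, L i := by
      rw [sum_sub_distrib, ← mul_sum, sum_sub_distrib]
      simp only [sum_const, card_range]
      simp
      ring
    have e2 : 2 * ∑ r ∈ range (m + 1), (2 * c + (2 * ((m : ℤ) + 1) - r) - 1) =
        2 * ((m + 1) * (2 * c + 2 * (m + 1) - 1)) - (m + 1) * m := by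
      have := hid (m + 1)
      push_cast at this
      rw [sum_sub_distrib, sum_add_distrib, sum_sub_distrib]
      simp only [sum_const, card_range]
      simp
      linarith
    have e3 := hid m
    push_cast
    rw [sum_range_succ] at e2
    linear_combination -2 * e1 - e2 + 2 * e3

end Evaluation

section TypeA

theorem isRegionA_regionA {x d m : ℕ} {l : ℕ → ℕ} :
    IsRegionA x d m (fun r : Fin m => l (r + 1)) (regionA x d m l) := by
  intro i j
  simp only [regionA, halvedHexagon, bump, mem_sdiff, mem_filter, mem_product, mem_Icc, mem_image,
    Prod.mk.injEq]
  constructor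
  · rintro ⟨⟨⟨⟨h1, h2⟩, h3, h4⟩, h5, h6⟩, h7⟩
    refine ⟨h1, h3, h4, h5, h6, ?_⟩
    rintro rfl ⟨y, hy⟩
    by_contra! h8
    refine h7 ⟨(y + 1).toNat, ⟨⟨by omega, by omega⟩, ?_⟩, rfl, by omega⟩
    rintro ⟨k, hk, hk'⟩
    refine h8 ⟨k - 1, by omega⟩ ?_
    simp only [Nat.sub_add_cancel hk.1]
    omega
  · rintro ⟨h1, h3, h4, h5, h6, h7⟩
    refine ⟨⟨⟨⟨h1, by omega⟩, h3, h4⟩, h5, h6⟩, ?_⟩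
    rintro ⟨k, ⟨hk, hk'⟩, rfl, rfl⟩
    obtain ⟨r, hr⟩ := h7 rfl ⟨(k : ℤ) - 1, by ring⟩
    exact hk' ⟨r + 1, ⟨by omega, r.2⟩, by omega⟩

variable {K : Type*} [Field K]

theorem tgf_regionA {q : K} (hq : q ≠ 0) (h2 : (2 : K) ≠ 0)
    (hqInt : ∀ k : ℕ, 0 < k → qInt (q ^ 2) k ≠ 0) {x d m : ℕ} (hmd : m ≤ d) {l : ℕ → ℕ}
    (hl : StrictMonoOn l (Set.Icc 1 m)) (hl_mem : ∀ i ∈ Set.Icc 1 m, l i ∈ Set.Icc 1 d) :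
    tgf (wt1 q) (regionA x d m l) =
      (∏ r ∈ range m, 2 ^ (r + 1)) *
      ((∏ i ∈ range m, symDoubleFact q (x + (d - m) + l (i + 1)) /
        (symDoubleFact q (x + d - l (i + 1)) *
          (2 ^ (2 * l (i + 1)) * symFact q (2 * l (i + 1) - 1)))) *
      ((∏ r ∈ range m, ∏ t ∈ Ico r (m - 1),
          symInt q (2 * (((x + (d - m) : ℕ) : ℤ) + ((t + 1 : ℕ) : ℤ) + 1) - (r + 1))) *
        ∏ j ∈ range m, ∏ i ∈ range j, symInt q (2 * (l (j + 1) : ℤ) - 2 * l (i + 1)))) := by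
  have hmem : ∀ r : Fin m, (r : ℕ) + 1 ∈ Set.Icc 1 m := fun r => ⟨by omega, r.2⟩
  have hb : StrictMono fun r : Fin m => l (r + 1) := fun r s hrs =>
    hl (hmem r) (hmem s) (by have : (r : ℕ) < s := hrs; omega)
  rw [tgf_eq_det hq h2 hqInt isRegionA_regionA hb (fun r => (hl_mem _ (hmem r)).2)
    (fun r => (hl_mem _ (hmem r)).1) hmd]
  have hc : (x : ℤ) + d - m = ((x + (d - m) : ℕ) : ℤ) := by omega
  have hentry : (Matrix.of fun r i : Fin m => pathGF q (x + d - m + 1) ((r : ℤ) - 1) (l (i + 1))) =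
      Matrix.of fun r i : Fin m => (2 : K) ^ ((r : ℕ) + 1) *
        (Matrix.of fun r i : Fin m => symDoubleFact q (x + (d - m) + l (i + 1)) /
          (symDoubleFact q (x + d - l (i + 1)) *
            (2 ^ (2 * l (i + 1)) * symFact q (2 * l (i + 1) - 1))) *
          (Matrix.of fun r i : Fin m => ∏ t ∈ range (m - 1),
            if t < (r : ℕ) then symInt q (2 * (l (i + 1) : ℤ) - (t + 1))
            else symInt q (2 * (((x + (d - m) : ℕ) : ℤ) + ((t + 1 : ℕ) : ℤ) + 1)
              - 2 * (l (i + 1) : ℤ))) r i) r i := by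
    ext r i
    have := (hl_mem _ (hmem i)).1
    have := (hl_mem _ (hmem i)).2
    simp only [Matrix.of_apply]
    rw [hc, pathGF_start hq h2 hqInt (m := m) r.2 (by omega)
      (show x + d - l (i + 1) + l (i + 1) = x + (d - m) + m by omega)]
  rw [hentry, Matrix.det_mul_column, Matrix.det_mul_row,
    det_symInt hq hqInt (fun t => 2 * (((x + (d - m) : ℕ) : ℤ) + (t : ℤ) + 1))
      (fun i : Fin m => 2 * (l (i + 1) : ℤ)),
    prod_fin_Ioi m (fun i j => symInt q (2 * (l (j + 1) : ℤ) - 2 * l (i + 1))),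
    Fin.prod_univ_eq_prod_range (fun r => (2 : K) ^ (r + 1)),
    Fin.prod_univ_eq_prod_range (fun i => symDoubleFact q (x + (d - m) + l (i + 1)) /
          (symDoubleFact q (x + d - l (i + 1)) *
            (2 ^ (2 * l (i + 1)) * symFact q (2 * l (i + 1) - 1)))),
    Fin.prod_univ_eq_prod_range (fun r => ∏ t ∈ Ico r (m - 1),
      symInt q (2 * (((x + (d - m) : ℕ) : ℤ) + ((t + 1 : ℕ) : ℤ) + 1) - (r + 1)))]

theorem prod_qInt {q : K} (hq : q ≠ 0) {ι : Type*} (s : Finset ι) (f : ι → ℕ) :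
    ∏ i ∈ s, qInt (q ^ 2) (f i) =
      q ^ (∑ i ∈ s, ((f i : ℤ) - 1)) * ∏ i ∈ s, symInt q (f i) := by
  simp only [qInt_sq_eq hq, prod_mul_distrib, prod_zpow_eq_zpow_sum hq]

theorem prod_prod_qInt {q : K} (hq : q ≠ 0) {ι κ : Type*} (s : Finset ι) (t : ι → Finset κ)
    (f : ι → κ → ℕ) :
    ∏ i ∈ s, ∏ j ∈ t i, qInt (q ^ 2) (f i j) =
      q ^ (∑ i ∈ s, ∑ j ∈ t i, ((f i j : ℤ) - 1)) * ∏ i ∈ s, ∏ j ∈ t i, symInt q (f i j) := by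
  simp only [prod_qInt hq, prod_mul_distrib, prod_zpow_eq_zpow_sum hq]

theorem qFact_sq_eq {q : K} (hq : q ≠ 0) (n : ℕ) :
    qFact (q ^ 2) n = q ^ (∑ k ∈ range n, (k : ℤ)) * symFact q n := by
  rw [qFact, prod_Icc_eq_prod_range_succ, prod_qInt hq]
  congr 2
  exact sum_congr rfl fun k _ => by push_cast; ring

/-- The last product of the formula, as a quotient of double factorials. -/
theorem prod_symInt_pair {q : K} (hq : q ≠ 0) (hqInt : ∀ k : ℕ, 0 < k → qInt (q ^ 2) k ≠ 0)
    {c m i k : ℕ} (hik : i ≤ k) (hk : k ≤ c + m) :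
    ∏ j ∈ Icc 1 (k - i), (qInt (q ^ 2) (2 * (c + i + j + 0)) *
        qInt (q ^ 2) (2 * (c + m + 1 - i - j))) =
      q ^ (((k : ℤ) - i) * (4 * c + 2 * m)) *
        (symDoubleFact q (c + k) / symDoubleFact q (c + i) *
          (symDoubleFact q (c + m - i) / symDoubleFact q (c + m - k))) := by
  have n1 := symDoubleFact_ne_zero hq hqInt (c + i)
  have n2 := symDoubleFact_ne_zero hq hqInt (c + m - k)
  rw [show c + k = c + i + (k - i) by omega, show c + m - i = c + m - k + (k - i) by omega,
    symDoubleFact_add q (c + i), symDoubleFact_add q (c + m - k), mul_div_cancel_left₀ _ n1, mul_div_cancel_left₀ _ n2,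
    prod_mul_distrib, prod_Icc_eq_prod_range_succ, prod_Icc_eq_prod_range_succ, prod_qInt hq, prod_qInt hq, mul_mul_mul_comm,
    ← zpow_add₀ hq, ← sum_add_distrib]
  congr 2
  · rw [sum_congr rfl (g := fun _ => (4 * (c : ℤ) + 2 * m)), sum_const, card_range]
    · rw [nsmul_eq_mul]
      congr 1
      omega
    · intro j hj
      rw [mem_range] at hj
      omega
  · rw [← prod_range_reflect]
    refine prod_congr rfl fun j hj => congrArg _ ?_
    rw [mem_range] at hj
    omega

theorem sum_range_two_mul_sub_one {k : ℕ} (hk : 1 ≤ k) :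
    2 * ∑ i ∈ range (2 * k - 1), (i : ℤ) = (2 * k - 1) * (2 * k - 2) := by
  have hid : ∀ n : ℕ, 2 * ∑ i ∈ range n, (i : ℤ) = n * (n - 1) := by
    intro n
    induction n with
    | zero => simp
    | succ n ih => rw [sum_range_succ, mul_add, ih]; push_cast; ring
  rw [hid, show ((2 * k - 1 : ℕ) : ℤ) = 2 * k - 1 by omega]
  ring

theorem prod_symDoubleFact_div {q : K} (hq : q ≠ 0) (hqInt : ∀ k : ℕ, 0 < k → qInt (q ^ 2) k ≠ 0)
    (c m : ℕ) :
    (∏ i ∈ range m, symDoubleFact q (c + m - (i + 1)) / symDoubleFact q (c + (i + 1))) *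
      ∏ t ∈ range m, symInt q (2 * ((c : ℤ) + t + 1)) = 1 := by
  have h : ∀ n : ℕ, symDoubleFact q n ≠ 0 := symDoubleFact_ne_zero hq hqInt
  have h1 : ∏ t ∈ range m, symInt q (2 * ((c : ℤ) + t + 1)) =
      symDoubleFact q (c + m) / symDoubleFact q c := by
    rw [symDoubleFact_add, mul_div_cancel_left₀ _ (h c)]
  have h3 : ∏ i ∈ range m, symDoubleFact q (c + m - (i + 1)) =
      ∏ i ∈ range m, symDoubleFact q (c + i) := by
    rw [← prod_range_reflect]
    refine prod_congr rfl fun i hi => ?_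
    rw [mem_range] at hi
    congr 1
    omega
  have h4 : ∏ i ∈ range m, symDoubleFact q (c + (i + 1)) ≠ 0 := prod_ne_zero_iff.2 fun _ _ => h _
  have h5 : (∏ i ∈ range m, symDoubleFact q (c + (i + 1))) * symDoubleFact q c =
      (∏ i ∈ range m, symDoubleFact q (c + i)) * symDoubleFact q (c + m) := by
    rw [← prod_range_succ (fun i => symDoubleFact q (c + i)),
      prod_range_succ' (fun i => symDoubleFact q (c + i)), add_zero]
  rw [prod_div_distrib, h1, h3, div_mul_div_comm, ← h5, div_self (mul_ne_zero h4 (h c))]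

end TypeA

section Product

variable {K : Type*} [Field K]

theorem xBar_zero (x d m : ℕ) : xBar x 0 d m 0 = x + (d - m) := by
  simp [xBar]

theorem expF_zero (m : ℕ) (l h : ℕ → ℕ) :
    expF m 0 l h = ∑ i ∈ range m, (2 * (l (i + 1) : ℤ) - (i + 1)) := by
  rw [expF, sum_Icc_eq_sum_range_succ]
  simp

theorem two_mul_expE_zero {x d m : ℕ} (hmd : m ≤ d) (l h : ℕ → ℕ)
    (hl : ∀ i < m, i + 1 ≤ l (i + 1)) :
    2 * expE x 0 d m 0 l h = ∑ i ∈ range m, (2 * (l (i + 1) : ℤ) - (i + 1)) *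
      (4 * ((x + (d - m) : ℕ) : ℤ) + 1 + 3 * (i + 1) - 2 * (l (i + 1) : ℤ)) := by
  have he : eParam 0 d m 0 = 0 := by
    simp only [eParam]
    omega
  have hf : ∀ t y, auxf t 0 y = 0 := fun t y => by simp [auxf]
  rw [expE, Nat.cast_zero, hf, sum_Icc_eq_sum_range_succ, show Icc 1 0 = ∅ from rfl, sum_empty, zero_add, add_zero,
    mul_sum]
  refine sum_congr rfl fun i hi => ?_
  have hi' := hl i (mem_range.1 hi)
  obtain ⟨n, hn⟩ : ∃ n : ℕ, 2 * l (i + 1) = i + 1 + n := ⟨2 * l (i + 1) - (i + 1), by omega⟩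
  have hn' : 2 * (l (i + 1) : ℤ) = i + 1 + n := by exact_mod_cast hn
  have hc : ((x + (d - m) : ℕ) : ℤ) = x + d - m := by omega
  rw [t1Param, he, hc]
  convert two_mul_angle (2 * ((x : ℤ) + d - m) + 1 + (i + 1) - n) n using 2
  · congr 1 <;> push_cast <;> linarith
  · linarith
  · linarith

theorem prod_staircase_symInt {q : K} (hq : q ≠ 0) (c m : ℕ) :
    ∏ i ∈ Icc 1 ((m + 1) / 2), ∏ j ∈ Icc 1 (2 * m + 3 - 4 * i),
        qInt (q ^ 2) (2 * c + 2 * i + j - 1) =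
      q ^ (∑ r ∈ range (m + 1), ∑ t ∈ Ico r m, (2 * (c : ℤ) + (2 * ((t : ℤ) + 1) - r) - 1)) *
      ((∏ r ∈ range m, ∏ t ∈ Ico r (m - 1),
          symInt q (2 * ((c : ℤ) + ((t + 1 : ℕ) : ℤ) + 1) - (r + 1))) *
        ∏ t ∈ range m, symInt q (2 * ((c : ℤ) + t + 1))) := by
  have h1 : ∏ i ∈ Icc 1 ((m + 1) / 2), ∏ j ∈ Icc 1 (2 * m + 3 - 4 * i),
        qInt (q ^ 2) (2 * c + 2 * i + j - 1) =
      ∏ i ∈ Icc 1 ((m + 1) / 2), ∏ j ∈ Icc 1 (2 * m + 3 - 4 * i),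
        qInt (q ^ 2) (2 * c + (2 * i + j - 1)) := by
    refine prod_congr rfl fun i hi => prod_congr rfl fun j hj => ?_
    rw [mem_Icc] at hi hj
    congr 1
    omega
  rw [h1, prod_staircase m (fun w => qInt (q ^ 2) (2 * c + w)), prod_prod_qInt hq]
  congr 2
  · refine sum_congr rfl fun r _ => sum_congr rfl fun t ht => ?_
    rw [mem_Ico] at ht
    omega
  · rw [prod_range_succ']
    congr 1
    · refine prod_congr rfl fun r hr => ?_
      rw [mem_range] at hr
      have := prod_Ico_add' (fun t => symInt q ((2 * c + (2 * (t + 1) - (r + 1)) : ℕ) : ℤ)) r (m - 1) 1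
      rw [Nat.sub_add_cancel (by omega)] at this
      rw [← this]
      refine prod_congr rfl fun t ht => congrArg _ ?_
      rw [mem_Ico] at ht
      omega
    · rw [range_eq_Ico]
      exact prod_congr rfl fun t _ => congrArg _ (by omega)

theorem prod_two_pow (h2 : (2 : K) ≠ 0) (m : ℕ) (L : ℕ → ℕ) :
    (∏ r ∈ range m, (2 : K) ^ (r + 1)) / ∏ i ∈ range m, (2 : K) ^ (2 * L i) =
      2 ^ (-∑ i ∈ range m, (2 * (L i : ℤ) - (i + 1))) := by
  rw [← prod_div_distrib, ← sum_neg_distrib, ← prod_zpow_eq_zpow_sum h2]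
  refine prod_congr rfl fun i _ => ?_
  rw [neg_sub, zpow_sub₀ h2]
  norm_cast

theorem le_of_strictMonoOn {m : ℕ} {l : ℕ → ℕ} (hl : StrictMonoOn l (Set.Icc 1 m))
    (h1 : ∀ i ∈ Set.Icc 1 m, 1 ≤ l i) : ∀ i < m, i + 1 ≤ l (i + 1) := by
  intro i
  induction i with
  | zero => exact fun hi => h1 1 ⟨le_rfl, hi⟩
  | succ i ih =>
    intro hi
    have := hl (a := i + 1) (b := i + 1 + 1) ⟨by omega, by omega⟩ ⟨by omega, hi⟩ (by omega)
    have := ih (by omega)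
    omega

theorem P_zero {q : K} (hq : q ≠ 0) (h2 : (2 : K) ≠ 0)
    (hqInt : ∀ k : ℕ, 0 < k → qInt (q ^ 2) k ≠ 0) {x d m : ℕ} (hmd : m ≤ d) {l : ℕ → ℕ}
    (hl : StrictMonoOn l (Set.Icc 1 m)) (hl_mem : ∀ i ∈ Set.Icc 1 m, l i ∈ Set.Icc 1 d)
    (h : ℕ → ℕ) :
    P q x 0 d m 0 l h =
      (∏ r ∈ range m, 2 ^ (r + 1)) *
      ((∏ i ∈ range m, symDoubleFact q (x + (d - m) + l (i + 1)) /
        (symDoubleFact q (x + d - l (i + 1)) *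
          (2 ^ (2 * l (i + 1)) * symFact q (2 * l (i + 1) - 1)))) *
      ((∏ r ∈ range m, ∏ t ∈ Ico r (m - 1),
          symInt q (2 * (((x + (d - m) : ℕ) : ℤ) + ((t + 1 : ℕ) : ℤ) + 1) - (r + 1))) *
        ∏ j ∈ range m, ∏ i ∈ range j, symInt q (2 * (l (j + 1) : ℤ) - 2 * l (i + 1)))) := by
  have hle := le_of_strictMonoOn hl fun i hi => (hl_mem i hi).1
  have hE := two_mul_expE_zero (x := x) hmd l h hle
  have hxd : x + d = x + (d - m) + m := by omega
  have hlc : ∀ i < m, l (i + 1) ≤ x + (d - m) + m := fun i hi => by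
    have := (hl_mem (i + 1) ⟨by omega, hi⟩).2
    omega
  unfold P
  rw [expF_zero, ← prod_two_pow h2 m fun i => l (i + 1), xBar_zero]
  rw [hxd]
  generalize x + (d - m) = c at *
  have hV : ∏ i ∈ Icc 1 m, ∏ j ∈ Icc (i + 1) m, qInt (q ^ 2) (2 * (l j - l i)) =
      q ^ (∑ j ∈ range m, ∑ i ∈ range j, (2 * ((l (j + 1) : ℤ) - l (i + 1)) - 1)) *
        ∏ j ∈ range m, ∏ i ∈ range j, symInt q (2 * (l (j + 1) : ℤ) - 2 * l (i + 1)) := by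
    rw [prod_Icc_Icc, prod_prod_qInt hq]
    have : ∀ j ∈ range m, ∀ i ∈ range j,
        ((2 * (l (j + 1) - l (i + 1)) : ℕ) : ℤ) = 2 * (l (j + 1) : ℤ) - 2 * l (i + 1) := by
      intro j hj i hi
      rw [mem_range] at hi hj
      have := hl (a := i + 1) (b := j + 1) ⟨by omega, by omega⟩ ⟨by omega, hj⟩ (by omega)
      omega
    refine congrArg₂ (· * ·) (congrArg _ ?_) ?_
    · exact sum_congr rfl fun j hj => sum_congr rfl fun i hi => by rw [this j hj i hi]; ring
    · exact prod_congr rfl fun j hj => prod_congr rfl fun i hi => by rw [this j hj i hi]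
  have hD : ∏ i ∈ Icc 1 m, qFact (q ^ 2) (2 * l i - 1) =
      q ^ (∑ i ∈ range m, ∑ k ∈ range (2 * l (i + 1) - 1), (k : ℤ)) *
        ∏ i ∈ range m, symFact q (2 * l (i + 1) - 1) := by
    rw [prod_Icc_eq_prod_range_succ]
    simp only [qFact_sq_eq hq, prod_mul_distrib, prod_zpow_eq_zpow_sum hq]
  have hW : ∏ i ∈ Icc 1 m, ∏ j ∈ Icc 1 (l i - i), (qInt (q ^ 2) (2 * (c + i + j + 0)) *
        qInt (q ^ 2) (2 * (c + m + 1 - i - j))) =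
      q ^ (∑ i ∈ range m, ((l (i + 1) : ℤ) - (i + 1)) * (4 * c + 2 * m)) *
        ((∏ i ∈ range m, symDoubleFact q (c + l (i + 1)) / symDoubleFact q (c + m - l (i + 1))) *
        ∏ i ∈ range m, symDoubleFact q (c + m - (i + 1)) / symDoubleFact q (c + (i + 1))) := by
    rw [prod_Icc_eq_prod_range_succ, ← prod_mul_distrib, ← prod_zpow_eq_zpow_sum hq, ← prod_mul_distrib]
    refine prod_congr rfl fun i hi => ?_
    rw [mem_range] at hi
    rw [prod_symInt_pair hq hqInt (hle i hi) (hlc i hi)]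
    push_cast
    congr 1
    rw [div_mul_div_comm, div_mul_div_comm, mul_comm (symDoubleFact q (c + (i + 1)))]
  have hexp : -expE x 0 d m 0 l h
      + (∑ j ∈ range m, ∑ i ∈ range j, (2 * ((l (j + 1) : ℤ) - l (i + 1)) - 1)
        - ∑ i ∈ range m, ∑ k ∈ range (2 * l (i + 1) - 1), (k : ℤ))
      + ∑ r ∈ range (m + 1), ∑ t ∈ Ico r m, (2 * (c : ℤ) + (2 * ((t : ℤ) + 1) - r) - 1)
      + ∑ i ∈ range m, ((l (i + 1) : ℤ) - (i + 1)) * (4 * c + 2 * m) = 0 := by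
    have h1 := exponent_identity c m fun i => l (i + 1)
    have h3 : 2 * ∑ i ∈ range m, ∑ k ∈ range (2 * l (i + 1) - 1), (k : ℤ) =
        ∑ i ∈ range m, (2 * (l (i + 1) : ℤ) - 1) * (2 * (l (i + 1) : ℤ) - 2) := by
      rw [mul_sum]
      refine sum_congr rfl fun i hi => sum_range_two_mul_sub_one ?_
      have := hle i (mem_range.1 hi)
      omega
    linarith
  have hone := prod_symDoubleFact_div hq hqInt c m
  simp only [show Icc 1 0 = ∅ from rfl, prod_empty, mul_one]
  rw [hV, hD, hW, prod_staircase_symInt hq]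
  have hexp' := congrArg (fun n : ℤ => q ^ n) hexp
  simp only [zpow_add₀ hq, zpow_sub₀ hq, zpow_zero] at hexp'
  simp only [prod_const_one]
  have key : ∀ A B e a b V D s₃ s₄ T S N Y R : K, e * (a / b) * s₃ * s₄ = 1 → R * T = 1 →
      A / B * e * (a * V / (b * D)) * (s₃ * (S * T)) * (s₄ * (N / Y * R)) =
        A * (N / (Y * (B * D)) * (S * V)) := by
    intro A B e a b V D s₃ s₄ T S N Y R h1 h3
    linear_combination (A * (N / (Y * (B * D)) * (S * V))) * (R * T * h1 + h3)
  rw [one_mul, mul_one, prod_div_distrib (s := range m), prod_div_distrib (s := range m)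
    (f := fun i => symDoubleFact q (c + l (i + 1))), prod_mul_distrib, prod_mul_distrib]
  exact key _ _ _ _ _ _ _ _ _ _ _ _ _ _ hexp' hone

theorem tgf_regionA_eq_P {q : K} (hq : q ≠ 0) (h2 : (2 : K) ≠ 0)
    (hqInt : ∀ k : ℕ, 0 < k → qInt (q ^ 2) k ≠ 0) {x d m : ℕ} (hmd : m ≤ d) {l : ℕ → ℕ}
    (hl : StrictMonoOn l (Set.Icc 1 m)) (hl_mem : ∀ i ∈ Set.Icc 1 m, l i ∈ Set.Icc 1 d)
    (h : ℕ → ℕ) : tgf (wt1 q) (regionA x d m l) = P q x 0 d m 0 l h := by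
  rw [tgf_regionA hq h2 hqInt hmd hl hl_mem, P_zero hq h2 hqInt hmd hl hl_mem]

end Product

end HalvedHexagon

theorem mainTheorem7 {K : Type*} [Field K] (q : K) (h2 : (2 : K) ≠ 0) (hq : q ≠ 0)
    (hqInt : ∀ k : ℕ, 0 < k → HalvedHexagon.qInt (q ^ 2) k ≠ 0)
    (x d m : ℕ) (hmd : m ≤ d) (l : ℕ → ℕ) (hl : StrictMonoOn l (Set.Icc 1 m))
    (hl_mem : ∀ i ∈ Set.Icc 1 m, l i ∈ Set.Icc 1 d) :
    HalvedHexagon.tgf (HalvedHexagon.wt1 q) (HalvedHexagon.regionA x d m l)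
      = HalvedHexagon.P q x 0 d m 0 l (fun _ => 0) := by
  exact HalvedHexagon.tgf_regionA_eq_P hq h2 hqInt hmd hl hl_mem _
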